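/- Let $m,c,k_B>0$, put $p^0=\sqrt{(mc)^2+|p|^2}$ and $p^\mu=(p^0,p)$ for $p\in\mathbb R^3$, and raise and lower indices with $\mathrm{diag}(1,-1,-1,-1)$. Let $\phi\ge 0$ be a measurable function on $(0,\infty)$ with $$\int_{\mathbb R^3}\int_0^\infty P(p^0,\mathcal I)\,e^{-C(1+\frac{\mathcal I}{mc^2})p^0}\phi(\mathcal I)\,d\mathcal I\,dp<\infty$$ for all $C>0$ and all polynomials $P$. For a distribution function $F(p,\mathcal I)$ let $$n^2=\Big(\iint F\phi\,d\mathcal I\,dp\Big)^2-\sum_{i=1}^3\Big(\iint p^iF\phi\,d\mathcal I\tfrac{dp}{p^0}\Big)^2,\quad n\ge 0,\qquad U^\mu=\frac cn\iint p^\mu F\phi\,d\mathcal I\tfrac{dp}{p^0},$$ $$e=\frac1c\iint (U^\mu p_\mu)^2F\big(1+\tfrac{\mathcal I}{mc^2}\big)\phi\,d\mathcal I\tfrac{dp}{p^0},\qquad q^\mu=c\iint p^\mu (U^\nu p_\nu) F\big(1+\tfrac{\mathcal I}{mc^2}\big)\phi\,d\mathcal I\tfrac{dp}{p^0}-U^\mu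 e,$$ where it is assumed that $\iint p^0(1+\frac{\mathcal I}{mc^2})|F|\phi\,d\mathcal I\,dp<\infty$, that the right-hand side of the first formula is positive, so that $n>0$, and that $\iint F\phi\,d\mathcal I\,dp>0$ (these two positivity conditions hold if $F\ge0$ and $F\phi$ is not almost everywhere zero). For $T>0$ let $$Z(T)=\iint e^{-\frac{mc^2+\mathcal I}{k_BT}\sqrt{1+|p|^2}}\phi\,d\mathcal I\,dp,\qquad \widetilde e(T)=\frac{1}{Z(T)}\iint\sqrt{1+|p|^2}\,(mc^2+\mathcal I)\,e^{-\frac{mc^2+\mathcal I}{k_BT}\sqrt{1+|p|^2}}\phi\,d\mathcal I\,dp .$$ Assume that $\widetilde e(T)=e/n$ has a unique solution $T>0$. With this $T$, define $g_r$, $F_E$ and $b$ by $$e^{-1+\frac{m}{k_B}\frac{g_r}{T}}=\frac{n}{(mc)^3Z(T)},\qquad F_E=\exp\Big\{-1+\frac m{k_B}\frac{g_r}T-\Big(1+\frac{\mathcal I}{mc^2}\Big)\frac{U^\mu p_\mu}{k_BT}\Big\},$$ $$b=\frac{nmc^2}{\gamma^2}\Big(\int_0^\infty\frac{K_2(\gamma^*)}{\gamma^*}\phi\,d\mathcal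 I\Big)^{-1}\int_0^\infty K_3(\gamma^*)\phi\,d\mathcal I,\qquad\gamma=\frac{mc^2}{k_BT},\quad\gamma^*=\gamma\Big(1+\frac{\mathcal I}{mc^2}\Big),$$ where $K_k(s)=\int_0^\infty\cosh(kr)e^{-s\cosh r}\,dr$, and put $$\widetilde F=\Big(1-p^\mu q_\mu\frac{1+\frac{\mathcal I}{mc^2}}{bmc^2}\Big)F_E .$$ Then all the integrals below converge, and for $\nu=0,1,2,3$ $$U_\mu\iint p^\mu\big(\widetilde F-F\big)\phi\,d\mathcal I\tfrac{dp}{p^0}=0,\qquad U_\mu\iint p^\mu p^\nu\big(\widetilde F-F\big)\big(1+\tfrac{\mathcal I}{mc^2}\big)\phi\,d\mathcal I\tfrac{dp}{p^0}=0 .$$ Consequently, let $\tau>0$, let $\Omega$ be an open set of points $(t,x)\in\mathbb R\times\mathbb R^3$, and let $F(t,x,p,\mathcal I)$ be such that the above assumptions (including the unique solvability for $T$) hold at every point of $\Omega$, that $F$ is differentiable in $(t,x)\in\Omega$ for all $p\in\mathbb R^3$ and $\mathcal I>0$ and satisfies there $$\partial_tF+\frac{c\,p}{p^0}\cdot\nabla_xF=\frac{U_\mu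 p^\mu}{c\tau p^0}\big(\widetilde F-F\big),$$ and that, locally uniformly in $(t,x)\in\Omega$, its first derivatives in $(t,x)$ are bounded by a function $g(p,\mathcal I)$ with $\iint p^0(1+\frac{\mathcal I}{mc^2})g\phi\,d\mathcal I\,dp<\infty$. Then $$V^\mu=mc\iint p^\mu F\phi\,d\mathcal I\tfrac{dp}{p^0},\qquad T^{\mu\nu}=\frac1{mc}\iint p^\mu p^\nu F(mc^2+\mathcal I)\phi\,d\mathcal I\tfrac{dp}{p^0}$$ are differentiable on $\Omega$ and satisfy $\partial_\mu V^\mu=0$ and $\partial_\mu T^{\mu\nu}=0$ there, where $x^0=ct$. -/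

import Mathlib

open MeasureTheory Set Topology

noncomputable section

namespace PennisiRuggeri

/-- Momentum space (and physical space) `ℝ³` with the Euclidean norm. -/
abbrev R3 := EuclideanSpace ℝ (Fin 3)

/-- Space-time points `(t, x)`; the space-time coordinates are `x⁰ = c t` and `xⁱ`. -/
abbrev Spacetime := ℝ × R3

/-- Minkowski product `u^μ v_μ = u⁰ v⁰ - ∑ uⁱ vⁱ` of two four-vectors given by their
contravariant components. -/
def mink (u v : Fin 4 → ℝ) : ℝ := u 0 * v 0 - ∑ i : Fin 3, u i.succ * v i.succ

/-- Modified Bessel function of the second kind,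
`K_k(s) = ∫₀^∞ cosh (k r) exp (-s cosh r) dr`. -/
def besselK (k : ℕ) (s : ℝ) : ℝ :=
  ∫ r in Ioi (0 : ℝ), Real.cosh (k * r) * Real.exp (-s * Real.cosh r)

/-- The data of a polyatomic gas: rest mass, speed of light, Boltzmann constant and
state density `φ(I)` of the internal mode (only its values at `I > 0` matter). -/
structure Gas where
  m : ℝ
  c : ℝ
  kB : ℝ
  φ : ℝ → ℝ

namespace Gas

variable (G : Gas)

/-- `p⁰ = √((mc)² + |p|²)`. -/
def p0 (p : R3) : ℝ := Real.sqrt ((G.m * G.c) ^ 2 + ‖p‖ ^ 2)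

/-- The four-momentum `(p⁰, p)`. -/
def fourMom (p : R3) : Fin 4 → ℝ := Fin.cons (G.p0 p) (fun i => p i)

/-- The factor `1 + I / (m c²)`. -/
def w (I : ℝ) : ℝ := 1 + I / (G.m * G.c ^ 2)

/-- The measure `dI dp` on `ℝ³ × (0, ∞)`. -/
def vol : Measure (R3 × ℝ) := (volume : Measure R3).prod (volume.restrict (Ioi (0 : ℝ)))

/-- Convergence of `∫_{ℝ³} ∫₀^∞ H(p, I) φ(I) dI dp`. -/
def PhaseIntegrable (H : R3 → ℝ → ℝ) : Prop :=
  Integrable (fun z : R3 × ℝ => H z.1 z.2 * G.φ z.2) vol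

/-- `∫_{ℝ³} ∫₀^∞ H(p, I) φ(I) dI dp`. -/
def phaseInt (H : R3 → ℝ → ℝ) : ℝ := ∫ z : R3 × ℝ, H z.1 z.2 * G.φ z.2 ∂vol

/-- Convergence of `∫_{ℝ³} ∫₀^∞ H(p, I) φ(I) dI dp/p⁰`. -/
def InvIntegrable (H : R3 → ℝ → ℝ) : Prop := G.PhaseIntegrable (fun p I => H p I / G.p0 p)

/-- `∫_{ℝ³} ∫₀^∞ H(p, I) φ(I) dI dp/p⁰`. -/
def invInt (H : R3 → ℝ → ℝ) : ℝ := G.phaseInt (fun p I => H p I / G.p0 p)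

/-- Standing assumptions: positive physical constants, `φ ≥ 0`, and
`∫∫ P(p⁰, I) exp (-C (1 + I/(mc²)) p⁰) φ(I) dI dp < ∞` for every `C > 0` and every polynomial
`P`. -/
structure Admissible : Prop where
  m_pos : 0 < G.m
  c_pos : 0 < G.c
  kB_pos : 0 < G.kB
  φ_measurable : Measurable G.φ
  φ_nonneg : ∀ I : ℝ, 0 < I → 0 ≤ G.φ I
  φ_decay : ∀ C : ℝ, 0 < C → ∀ P : MvPolynomial (Fin 2) ℝ,
    G.PhaseIntegrable (fun p I =>
      MvPolynomial.eval ![G.p0 p, I] P * Real.exp (-C * G.w I * G.p0 p))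

/-! ### Macroscopic fields of a distribution function `F(p, I)` -/

/-- Particle flux `V^μ = m c ∫∫ p^μ F φ dI dp/p⁰`. -/
def particleFlux (F : R3 → ℝ → ℝ) (μ : Fin 4) : ℝ :=
  G.m * G.c * G.invInt (fun p I => G.fourMom p μ * F p I)

/-- Energy-momentum tensor `T^{μν} = (mc)⁻¹ ∫∫ p^μ p^ν F (mc² + I) φ dI dp/p⁰`. -/
def energyMomentum (F : R3 → ℝ → ℝ) (μ ν : Fin 4) : ℝ :=
  1 / (G.m * G.c) * G.invInt (fun p I =>
    G.fourMom p μ * G.fourMom p ν * F p I * (G.m * G.c ^ 2 + I))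

/-- `n`, the nonnegative square root of
`(∫∫ F φ dI dp)² - ∑ᵢ (∫∫ pⁱ F φ dI dp/p⁰)²`. -/
def numDensity (F : R3 → ℝ → ℝ) : ℝ :=
  Real.sqrt ((G.phaseInt F) ^ 2 - ∑ i : Fin 3, (G.invInt (fun p I => p i * F p I)) ^ 2)

/-- `U^μ = (c/n) ∫∫ p^μ F φ dI dp/p⁰`. -/
def velocity (F : R3 → ℝ → ℝ) (μ : Fin 4) : ℝ :=
  G.c / G.numDensity F * G.invInt (fun p I => G.fourMom p μ * F p I)

/-- `e = c⁻¹ ∫∫ (U^μ p_μ)² F (1 + I/(mc²)) φ dI dp/p⁰`. -/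
def energy (F : R3 → ℝ → ℝ) : ℝ :=
  1 / G.c * G.invInt (fun p I => (mink (G.velocity F) (G.fourMom p)) ^ 2 * F p I * G.w I)

/-- Heat flux `q^μ = c ∫∫ p^μ (U^ν p_ν) F (1 + I/(mc²)) φ dI dp/p⁰
  - c⁻¹ U^μ ∫∫ (U^ν p_ν)² F (1 + I/(mc²)) φ dI dp/p⁰`. -/
def heatFlux (F : R3 → ℝ → ℝ) (μ : Fin 4) : ℝ :=
  G.c * G.invInt (fun p I =>
      G.fourMom p μ * mink (G.velocity F) (G.fourMom p) * F p I * G.w I)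
    - 1 / G.c * G.velocity F μ *
      G.invInt (fun p I => (mink (G.velocity F) (G.fourMom p)) ^ 2 * F p I * G.w I)

/-- `F` has convergent moments `V^μ`, `T^{μν}` and an Eckart frame: `n > 0` and `V⁰ > 0`
(so that `U^μ = (√(c² + |U|²), U)`). This holds, e.g., for every `F ≥ 0` with convergent
moments that does not vanish `φ dI dp`-almost everywhere. -/
structure HasEckartFrame (F : R3 → ℝ → ℝ) : Prop where
  moments : G.PhaseIntegrable (fun p I => G.p0 p * G.w I * F p I)
  n_pos : 0 < G.numDensity F
  total_pos : 0 < G.phaseInt F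

/-! ### Equilibrium -/

/-- `∫∫ exp (-(mc² + I) √(1+|p|²) / (k_B T)) φ dI dp`. -/
def partitionFn (T : ℝ) : ℝ :=
  G.phaseInt (fun p I =>
    Real.exp (-(G.m * G.c ^ 2 + I) * (1 / (G.kB * T)) * Real.sqrt (1 + ‖p‖ ^ 2)))

/-- The function `ẽ(T)`. -/
def eTilde (T : ℝ) : ℝ :=
  G.phaseInt (fun p I =>
      Real.sqrt (1 + ‖p‖ ^ 2) *
        Real.exp (-(G.m * G.c ^ 2 + I) * (1 / (G.kB * T)) * Real.sqrt (1 + ‖p‖ ^ 2)) *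
        (G.m * G.c ^ 2 + I)) / G.partitionFn T

/-- `T > 0` solves `ẽ(T) = e/n`. -/
def IsTemperature (F : R3 → ℝ → ℝ) (T : ℝ) : Prop :=
  0 < T ∧ G.eTilde T = G.energy F / G.numDensity F

/-- The relativistic chemical potential `g_r`, i.e. the solution of
`exp (-1 + (m/k_B) g_r/T) = n / ((mc)³ ∫∫ exp (-(mc² + I) √(1+|p|²) / (k_B T)) φ dI dp)`;
see `exp_chemPot`. -/
def chemPot (F : R3 → ℝ → ℝ) (T : ℝ) : ℝ :=
  G.kB * T / G.m *
    (1 + Real.log (G.numDensity F / ((G.m * G.c) ^ 3 * G.partitionFn T)))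

theorem exp_chemPot (F : R3 → ℝ → ℝ) (T : ℝ) (hm : 0 < G.m) (hc : 0 < G.c) (hk : 0 < G.kB)
    (hT : 0 < T) (hn : 0 < G.numDensity F) (hZ : 0 < G.partitionFn T) :
    Real.exp (-1 + G.m / G.kB * (G.chemPot F T / T)) =
      G.numDensity F / ((G.m * G.c) ^ 3 * G.partitionFn T) := by
  have h : -1 + G.m / G.kB * (G.chemPot F T / T) =
      Real.log (G.numDensity F / ((G.m * G.c) ^ 3 * G.partitionFn T)) := by
    unfold chemPot
    field_simp
    ring
  rw [h, Real.exp_log (by positivity)]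

/-- The equilibrium distribution
`F_E = exp (-1 + (m/k_B) g_r/T - (1 + I/(mc²)) U^μ p_μ / (k_B T))`. -/
def equilibrium (F : R3 → ℝ → ℝ) (T : ℝ) (p : R3) (I : ℝ) : ℝ :=
  Real.exp (-1 + G.m / G.kB * (G.chemPot F T / T)
    - G.w I * (1 / (G.kB * T)) * mink (G.velocity F) (G.fourMom p))

/-- `γ = mc² / (k_B T)`. -/
def γ (T : ℝ) : ℝ := G.m * G.c ^ 2 / (G.kB * T)

/-- `b = (n mc²/γ²) (∫₀^∞ K₂(γ*)/γ* φ dI)⁻¹ ∫₀^∞ K₃(γ*) φ dI` with `γ* = γ (1 + I/(mc²))`. -/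
def b (F : R3 → ℝ → ℝ) (T : ℝ) : ℝ :=
  G.numDensity F * G.m * G.c ^ 2 / (G.γ T) ^ 2 *
    (∫ I in Ioi (0 : ℝ), besselK 2 (G.γ T * G.w I) / (G.γ T * G.w I) * G.φ I)⁻¹ *
    ∫ I in Ioi (0 : ℝ), besselK 3 (G.γ T * G.w I) * G.φ I

/-- The modified equilibrium `(1 - p^μ q_μ (1 + I/(mc²)) / (b m c²)) F_E`. -/
def modEquilibrium (F : R3 → ℝ → ℝ) (T : ℝ) (p : R3) (I : ℝ) : ℝ :=
  (1 - mink (G.fourMom p) (G.heatFlux F) * (G.w I / (G.b F T * G.m * G.c ^ 2))) *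
    G.equilibrium F T p I

/-! ### The Pennisi-Ruggeri equation -/

/-- The vectors along which `∂_μ = ∂/∂x^μ` differentiates functions of `(t, x)`; as
`x⁰ = c t`, `∂₀ = c⁻¹ ∂_t`. -/
def coordDir : Fin 4 → Spacetime :=
  Fin.cons (1 / G.c, 0) (fun i => (0, EuclideanSpace.single i 1))

/-- `∂_μ A^μ` at the space-time point `X`. -/
def divergence (A : Spacetime → Fin 4 → ℝ) (X : Spacetime) : ℝ :=
  ∑ μ : Fin 4, fderiv ℝ (fun Y => A Y μ) X (G.coordDir μ)

/-- `F(t, x, p, I)`, with temperature field `T(t, x)`, is a classical solution on `Ω` of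
`∂_t F + p̂·∇ₓF = U_μ p^μ/(c τ p⁰) {(1 - p^μ q_μ (1 + I/(mc²))/(b mc²)) F_E - F}`,
`p̂ = c p/p⁰`, whose first derivatives in `(t, x)` are locally dominated by a function of `(p, I)`
with convergent moments. The temperature is the unique solution of `ẽ(T) = e/n`. -/
structure IsClassicalSolution (τ : ℝ) (Ω : Set Spacetime) (F : Spacetime → R3 → ℝ → ℝ)
    (T : Spacetime → ℝ) : Prop where
  frame : ∀ X ∈ Ω, G.HasEckartFrame (F X)
  temperature_unique : ∀ X ∈ Ω, ∃! S : ℝ, G.IsTemperature (F X) S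
  temperature : ∀ X ∈ Ω, G.IsTemperature (F X) (T X)
  differentiable : ∀ p : R3, ∀ I : ℝ, 0 < I → DifferentiableOn ℝ (fun Y => F Y p I) Ω
  dominated : ∀ X ∈ Ω, ∃ g : R3 → ℝ → ℝ,
    G.PhaseIntegrable (fun p I => G.p0 p * G.w I * g p I) ∧
    ∀ᶠ Y in 𝓝 X, ∀ p : R3, ∀ I : ℝ, 0 < I → ‖fderiv ℝ (fun Z => F Z p I) Y‖ ≤ g p I
  equation : ∀ X ∈ Ω, ∀ p : R3, ∀ I : ℝ, 0 < I →
    fderiv ℝ (fun Y => F Y p I) X (1, 0) +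
        fderiv ℝ (fun Y => F Y p I) X (0, (G.c / G.p0 p) • p) =
      mink (G.velocity (F X)) (G.fourMom p) / (G.c * τ * G.p0 p) *
        (G.modEquilibrium (F X) (T X) p I - F X p I)

end Gas

end PennisiRuggeri

end

open MeasureTheory Set Topology

noncomputable section

namespace PennisiRuggeri

/-! Write `S^ν = ∫∫ p^ν (U·p) F w φ dI dp/p⁰` (`frameFlux`), with `w = 1 + I/(mc²)`. The definitions
of `n`, `e` and `q` say exactly that `F` satisfies `∫∫ (U·p) F φ dI dp/p⁰ = c n` and `c S = e U +
q`, where `U·q = 0`. The first claim is therefore that the modified equilibrium has these same two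
moments.

Both moments are computed in the rest frame. Since `U/c` is a future-directed unit timelike vector,
it is the image of the time axis under a boost, and `dp/p⁰` is boost invariant (`invInt_boost`).
There, with `β = c/(k_B T)`, the modified equilibrium is `n/E₀ · exp (-β w p⁰)` times a factor
linear in a purely spatial `q` (`modEquilibrium_boost`), where `E₀ = ∫∫ exp (-β w p⁰) φ dI dp`.
Rotation and reflection symmetry of the Boltzmann factor does the rest. The correction drops out of
the particle moment by oddness. In the other moment the equilibrium part contributes only to the
time component, with value `e/c` by the choice of `T`. The correction contributes only a multiple of
`q`, through the isotropic second moment `E₂ = ∫∫ |p|² w² exp (-β w p⁰) φ dI dp`. Integral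
representations of `K₂` and `K₃` give `b = n E₂/(3 m E₀)` (`b_eq`), which makes that multiple
`1/c²`. Boosting back gives `(e U + q)/c` (`invInt_velocity_fourMom_modEquilibrium`).

For the conservation laws, the moments are differentiated under the integral by domination. The
divergence assembles `p^μ ∂_μ F / p⁰`, which the equation turns into the collision term, and its
integral is one of the vanishing moments (`sum_fderiv_invInt`). -/

/-! ### Lorentz boosts of four-vectors -/

/-- The time component `√(1 + |u|²)` of the unit four-velocity with spatial part `u`. -/
def lorentzFactor (u : R3) : ℝ := Real.sqrt (1 + ‖u‖ ^ 2)

lemma lorentzFactor_pos (u : R3) : 0 < lorentzFactor u := Real.sqrt_pos.2 (by positivity)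

lemma lorentzFactor_sq (u : R3) : lorentzFactor u ^ 2 = 1 + ∑ i, u i ^ 2 := by
  rw [lorentzFactor, Real.sq_sqrt (by positivity), EuclideanSpace.real_norm_sq_eq]

lemma lorentzFactor_neg (u : R3) : lorentzFactor (-u) = lorentzFactor u := by
  simp [lorentzFactor]

/-- The time axis vector `(1, 0, 0, 0)`. -/
def timeAxis : Fin 4 → ℝ := Fin.cons 1 0

/-- The pure boost mapping `(1, 0)` to `(√(1 + |u|²), u)`. -/
def lorentz (u : R3) : (Fin 4 → ℝ) →ₗ[ℝ] (Fin 4 → ℝ) where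
  toFun x := Fin.cons (lorentzFactor u * x 0 + ∑ i : Fin 3, u i * x i.succ)
    (fun i => x i.succ +
      ((∑ j : Fin 3, u j * x j.succ) / (1 + lorentzFactor u) + x 0) * u i)
  map_add' x y := by
    ext i
    refine Fin.cases ?_ (fun i => ?_) i
    · simp [Fin.sum_univ_three]; ring
    · simp [Fin.sum_univ_three]; ring
  map_smul' a x := by
    ext i
    refine Fin.cases ?_ (fun i => ?_) i
    · simp [Fin.sum_univ_three]; ring
    · simp [Fin.sum_univ_three]; ring

@[simp] lemma lorentz_zero (u : R3) (x : Fin 4 → ℝ) :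
    lorentz u x 0 = lorentzFactor u * x 0 + ∑ i : Fin 3, u i * x i.succ := rfl

@[simp] lemma lorentz_succ (u : R3) (x : Fin 4 → ℝ) (i : Fin 3) :
    lorentz u x i.succ = x i.succ +
      ((∑ j : Fin 3, u j * x j.succ) / (1 + lorentzFactor u) + x 0) * u i := rfl

/-- Only the time components and the components along `u` change. With `|u|² = g² - 1`, everything
reduces to the scalar identity `key` in `g`, `x 0`, `y 0` and the contractions `a`, `b`. -/
lemma mink_lorentz (u : R3) (x y : Fin 4 → ℝ) :
    mink (lorentz u x) (lorentz u y) = mink x y := by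
  have h := lorentzFactor_sq u
  have h0 := lorentzFactor_pos u
  simp only [mink, lorentz_zero, lorentz_succ, Fin.sum_univ_three] at h ⊢
  generalize lorentzFactor u = g at *
  have h2 : u 2 ^ 2 = g ^ 2 - 1 - u 0 ^ 2 - u 1 ^ 2 := by linarith
  set a := u 0 * x (Fin.succ 0) + u 1 * x (Fin.succ 1) + u 2 * x (Fin.succ 2) with ha
  set b := u 0 * y (Fin.succ 0) + u 1 * y (Fin.succ 1) + u 2 * y (Fin.succ 2) with hb
  have key : (g * x 0 + a) * (g * y 0 + b) - (a * (b / (1 + g) + y 0) + b * (a / (1 + g) + x 0)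
      + (g ^ 2 - 1) * (a / (1 + g) + x 0) * (b / (1 + g) + y 0)) = x 0 * y 0 := by
    field_simp
    ring
  have : (g ^ 2 - 1) = u 0 ^ 2 + u 1 ^ 2 + u 2 ^ 2 := by linarith
  rw [this] at key
  rw [← key, ha, hb]
  ring

lemma lorentz_neg_lorentz (u : R3) (x : Fin 4 → ℝ) : lorentz (-u) (lorentz u x) = x := by
  have h := lorentzFactor_sq u
  have h0 := lorentzFactor_pos u
  simp only [Fin.sum_univ_three] at h
  ext i
  refine Fin.cases ?_ (fun i => ?_) i
  · simp only [lorentz_zero, lorentz_succ, lorentzFactor_neg, Fin.sum_univ_three, PiLp.neg_apply]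
    generalize lorentzFactor u = g at *
    set a := u 0 * x (Fin.succ 0) + u 1 * x (Fin.succ 1) + u 2 * x (Fin.succ 2) with ha
    have key : g * (g * x 0 + a) - (a + (g ^ 2 - 1) * (a / (1 + g) + x 0)) = x 0 := by
      field_simp
      ring
    rw [show g ^ 2 - 1 = u 0 ^ 2 + u 1 ^ 2 + u 2 ^ 2 by linarith] at key
    refine Eq.trans ?_ key
    rw [ha]
    ring
  · simp only [lorentz_zero, lorentz_succ, lorentzFactor_neg, Fin.sum_univ_three, PiLp.neg_apply]
    generalize lorentzFactor u = g at *
    set a := u 0 * x (Fin.succ 0) + u 1 * x (Fin.succ 1) + u 2 * x (Fin.succ 2) with ha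
    have e : -u 0 * (x (Fin.succ 0) + (a / (1 + g) + x 0) * u 0) +
        -u 1 * (x (Fin.succ 1) + (a / (1 + g) + x 0) * u 1) +
        -u 2 * (x (Fin.succ 2) + (a / (1 + g) + x 0) * u 2) =
        -a - (g ^ 2 - 1) * (a / (1 + g) + x 0) := by
      rw [show g ^ 2 - 1 = u 0 ^ 2 + u 1 ^ 2 + u 2 ^ 2 by linarith, ha]
      ring
    rw [e]
    field_simp
    ring

lemma lorentz_lorentz_neg (u : R3) (x : Fin 4 → ℝ) : lorentz u (lorentz (-u) x) = x := by
  simpa using lorentz_neg_lorentz (-u) x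

/-- Every future-directed unit timelike vector is the image of the time axis under a boost. -/
lemma exists_lorentz_timeAxis {V : Fin 4 → ℝ} (hV : mink V V = 1) (h0 : 0 < V 0) :
    ∃ u : R3, lorentz u timeAxis = V := by
  let u : R3 := WithLp.toLp 2 (fun i => V i.succ)
  have hu : ∀ i, u i = V i.succ := fun i => rfl
  refine ⟨u, ?_⟩
  ext i
  refine Fin.cases ?_ (fun i => ?_) i
  · have h1 : lorentzFactor u = V 0 := by
      have h2 := lorentzFactor_sq u
      have h3 := lorentzFactor_pos u
      simp only [mink, Fin.sum_univ_three, hu] at hV h2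
      -- Both sides are positive and have the same square `1 + ∑ (Vⁱ)²`.
      nlinarith
    simp [timeAxis, h1]
  · simp [timeAxis, hu]

lemma mink_comm (x y : Fin 4 → ℝ) : mink x y = mink y x := by
  simp [mink, mul_comm]

lemma mink_timeAxis (x : Fin 4 → ℝ) : mink timeAxis x = x 0 := by
  simp [mink, timeAxis]

/-- `mink v`, as a linear map. -/
def minkLin (v : Fin 4 → ℝ) : (Fin 4 → ℝ) →ₗ[ℝ] ℝ where
  toFun := mink v
  map_add' x y := by simp [mink, Fin.sum_univ_three]; ring
  map_smul' a x := by simp [mink, Fin.sum_univ_three]; ring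

@[simp] lemma minkLin_apply (v x : Fin 4 → ℝ) : minkLin v x = mink v x := rfl

lemma mink_add_right (v x y : Fin 4 → ℝ) : mink v (x + y) = mink v x + mink v y :=
  (minkLin v).map_add x y

lemma mink_smul_right (v : Fin 4 → ℝ) (a : ℝ) (x : Fin 4 → ℝ) :
    mink v (a • x) = a * mink v x := (minkLin v).map_smul a x

lemma mink_smul_left (a : ℝ) (x v : Fin 4 → ℝ) : mink (a • x) v = a * mink x v := by
  rw [mink_comm, mink_smul_right, mink_comm]

/-! ### Energy and momentum on the mass shell -/

namespace Gas

variable (G : Gas)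

@[simp] lemma fourMom_zero (p : R3) : G.fourMom p 0 = G.p0 p := rfl

@[simp] lemma fourMom_succ (p : R3) (i : Fin 3) : G.fourMom p i.succ = p i := rfl

lemma p0_sq (p : R3) : G.p0 p ^ 2 = (G.m * G.c) ^ 2 + ‖p‖ ^ 2 := Real.sq_sqrt (by positivity)

lemma p0_nonneg (p : R3) : 0 ≤ G.p0 p := Real.sqrt_nonneg _

lemma norm_le_p0 (p : R3) : ‖p‖ ≤ G.p0 p :=
  Real.le_sqrt_of_sq_le (by nlinarith [sq_nonneg (G.m * G.c)])

lemma abs_fourMom_le (p : R3) (μ : Fin 4) : |G.fourMom p μ| ≤ G.p0 p := by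
  refine Fin.cases ?_ (fun i => ?_) μ
  · simp [abs_of_nonneg (G.p0_nonneg p)]
  · exact (PiLp.norm_apply_le p i).trans (G.norm_le_p0 p)

variable {G} in
lemma Admissible.mc_pos (hG : G.Admissible) : 0 < G.m * G.c := mul_pos hG.m_pos hG.c_pos

variable {G} in
lemma Admissible.mc_le_p0 (_hG : G.Admissible) (p : R3) : G.m * G.c ≤ G.p0 p :=
  Real.le_sqrt_of_sq_le (by nlinarith [sq_nonneg ‖p‖])

variable {G} in
lemma Admissible.p0_pos (hG : G.Admissible) (p : R3) : 0 < G.p0 p :=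
  hG.mc_pos.trans_le (hG.mc_le_p0 p)

/-! ### Boosts on momentum space -/

/-- The action of the boost `lorentz u` on momenta of the mass shell. -/
def boost (u p : R3) : R3 := p + (inner ℝ u p / (1 + lorentzFactor u) + G.p0 p) • u

lemma inner_eq_sum (u p : R3) : inner ℝ u p = ∑ i, u i * p i := by
  simp [PiLp.inner_apply, mul_comm]

/-- The right-hand side is nonnegative by Cauchy–Schwarz together with `‖u‖ ≤ lorentzFactor u` and
`‖p‖ ≤ p⁰`, so it is enough to compare squares. -/
lemma p0_boost (u p : R3) :
    G.p0 (G.boost u p) = lorentzFactor u * G.p0 p + inner ℝ u p := by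
  have hg := lorentzFactor_pos u
  have hg2 : lorentzFactor u ^ 2 = 1 + ‖u‖ ^ 2 := Real.sq_sqrt (by positivity)
  have hp := G.p0_sq p
  have hnn : 0 ≤ lorentzFactor u * G.p0 p + inner ℝ u p := by
    have h1 : |inner ℝ u p| ≤ ‖u‖ * ‖p‖ := abs_real_inner_le_norm u p
    have h2 : ‖u‖ ≤ lorentzFactor u := Real.le_sqrt_of_sq_le (by linarith)
    have h3 := mul_le_mul h2 (G.norm_le_p0 p) (norm_nonneg _) hg.le
    linarith [(abs_le.1 h1).1]
  rw [← Real.sqrt_sq hnn, p0.eq_1 G (G.boost u p), boost, norm_add_sq_real, norm_smul, mul_pow _ ‖u‖ 2,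
    Real.norm_eq_abs, sq_abs, inner_smul_right, real_inner_comm p u,
    show ‖u‖ ^ 2 = lorentzFactor u ^ 2 - 1 by linarith,
    show ‖p‖ ^ 2 = G.p0 p ^ 2 - (G.m * G.c) ^ 2 by linarith]
  congr 1
  field_simp
  ring

lemma fourMom_boost (u p : R3) : G.fourMom (G.boost u p) = lorentz u (G.fourMom p) := by
  ext i
  refine Fin.cases ?_ (fun i => ?_) i
  · simp [p0_boost, inner_eq_sum]
  · simp [boost, inner_eq_sum]

lemma fourMom_injective : Function.Injective G.fourMom := by
  intro p q h
  ext i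
  simpa using congrFun h i.succ

lemma boost_neg_boost (u p : R3) : G.boost (-u) (G.boost u p) = p :=
  G.fourMom_injective (by simp only [fourMom_boost, lorentz_neg_lorentz])

lemma boost_boost_neg (u p : R3) : G.boost u (G.boost (-u) p) = p := by
  simpa using G.boost_neg_boost (-u) p

@[fun_prop]
lemma continuous_p0 : Continuous G.p0 := by unfold p0; fun_prop

lemma continuous_boost (u : R3) : Continuous (G.boost u) := by
  unfold boost
  fun_prop

/-- `boost u` as a homeomorphism of momentum space. -/
def boostHomeo (u : R3) : R3 ≃ₜ R3 where
  toFun := G.boost u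
  invFun := G.boost (-u)
  left_inv := G.boost_neg_boost u
  right_inv := G.boost_boost_neg u
  continuous_toFun := G.continuous_boost u
  continuous_invFun := G.continuous_boost (-u)

/-- The derivative of `boost u` at `p`. -/
def boostDeriv (u p : R3) : R3 →L[ℝ] R3 :=
  ContinuousLinearMap.id ℝ R3 +
    ((1 + lorentzFactor u)⁻¹ • innerSL ℝ u + (G.p0 p)⁻¹ • innerSL ℝ p).smulRight u

lemma hasFDerivAt_p0 (hG : G.Admissible) (p : R3) :
    HasFDerivAt G.p0 ((G.p0 p)⁻¹ • innerSL ℝ p) p := by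
  have h := ((hasStrictFDerivAt_norm_sq p).hasFDerivAt.const_add ((G.m * G.c) ^ 2)).sqrt
    (by have := hG.mc_pos; positivity)
  refine h.congr_fderiv ?_
  ext v
  have := hG.p0_pos p
  simp only [smul_apply, smul_eq_mul, innerSL_apply_apply, nsmul_eq_mul, ← p0.eq_1]
  push_cast
  field_simp

lemma hasFDerivAt_boost (hG : G.Admissible) (u p : R3) :
    HasFDerivAt (G.boost u) (G.boostDeriv u p) p := by
  have h1 : HasFDerivAt (fun p : R3 => inner ℝ u p / (1 + lorentzFactor u))
      ((1 + lorentzFactor u)⁻¹ • innerSL ℝ u) p := by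
    have := ((innerSL ℝ u).hasFDerivAt (x := p)).const_smul ((1 + lorentzFactor u)⁻¹)
    refine this.congr_of_eventuallyEq (Filter.Eventually.of_forall fun q => ?_)
    simp [div_eq_inv_mul]
  exact (hasFDerivAt_id p).add ((h1.add (G.hasFDerivAt_p0 hG p)).smul_const u)

/-- The derivative is the identity plus a rank-one map, so its determinant is `1 + |u|²/(1+g) +
u·p/p⁰`. As `|u|² = g² - 1`, this is `g + u·p/p⁰`. -/
lemma det_boostDeriv (hG : G.Admissible) (u p : R3) :
    (G.boostDeriv u p).det = G.p0 (G.boost u p) / G.p0 p := by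
  have h : (G.boostDeriv u p : R3 →ₗ[ℝ] R3) = LinearMap.transvection
      (((1 + lorentzFactor u)⁻¹ • innerSL ℝ u + (G.p0 p)⁻¹ • innerSL ℝ p : R3 →L[ℝ] ℝ) :
        R3 →ₗ[ℝ] ℝ) u := by
    ext v
    simp [boostDeriv, LinearMap.transvection]
  rw [ContinuousLinearMap.det, h, LinearMap.transvection.det, p0_boost]
  have hp := hG.p0_pos p
  have hg := lorentzFactor_pos u
  have hg2 : lorentzFactor u ^ 2 = 1 + ‖u‖ ^ 2 := Real.sq_sqrt (by positivity)
  simp only [ContinuousLinearMap.coe_coe, add_apply,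
    smul_apply, innerSL_apply_apply, smul_eq_mul, real_inner_self_eq_norm_sq]
  rw [real_inner_comm p u, show ‖u‖ ^ 2 = lorentzFactor u ^ 2 - 1 by linarith]
  field_simp
  ring

end Gas

namespace Gas

variable (G : Gas)

/-! ### Phase space integrals -/

instance : SFinite vol := by unfold vol; infer_instance

lemma ae_vol_pos : ∀ᵐ z ∂vol, 0 < z.2 :=
  Measure.quasiMeasurePreserving_snd.ae (p := fun I : ℝ => 0 < I)
    (ae_restrict_mem measurableSet_Ioi)

lemma ae_vol_fst_ne_zero : ∀ᵐ z ∂vol, z.1 ≠ 0 :=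
  Measure.quasiMeasurePreserving_fst.ae (p := fun p : R3 => p ≠ 0)
    (Measure.ae_ne volume 0)

lemma phaseInt_congr {H K : R3 → ℝ → ℝ} (h : ∀ p I, 0 < I → H p I = K p I) :
    G.phaseInt H = G.phaseInt K :=
  integral_congr_ae (ae_vol_pos.mono fun z hz => by simp only [h z.1 z.2 hz])

lemma invInt_congr {H K : R3 → ℝ → ℝ} (h : ∀ p I, 0 < I → H p I = K p I) :
    G.invInt H = G.invInt K :=
  G.phaseInt_congr fun p I hI => by rw [h p I hI]

variable {G}

lemma PhaseIntegrable.congr {H K : R3 → ℝ → ℝ} (hH : G.PhaseIntegrable H)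
    (h : ∀ p I, 0 < I → H p I = K p I) : G.PhaseIntegrable K :=
  Integrable.congr hH (ae_vol_pos.mono fun z hz => by simp only [h z.1 z.2 hz])

lemma InvIntegrable.congr {H K : R3 → ℝ → ℝ} (hH : G.InvIntegrable H)
    (h : ∀ p I, 0 < I → H p I = K p I) : G.InvIntegrable K :=
  PhaseIntegrable.congr hH fun p I hI => by simp only [h p I hI]

lemma PhaseIntegrable.add {H K : R3 → ℝ → ℝ} (hH : G.PhaseIntegrable H)
    (hK : G.PhaseIntegrable K) : G.PhaseIntegrable (fun p I => H p I + K p I) :=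
  (Integrable.add hH hK).congr (.of_forall fun z => by simp [add_mul])

lemma PhaseIntegrable.const_mul {H : R3 → ℝ → ℝ} (hH : G.PhaseIntegrable H) (a : ℝ) :
    G.PhaseIntegrable (fun p I => a * H p I) :=
  (Integrable.const_mul hH a).congr (.of_forall fun z => by simp [mul_assoc])

lemma InvIntegrable.add {H K : R3 → ℝ → ℝ} (hH : G.InvIntegrable H)
    (hK : G.InvIntegrable K) : G.InvIntegrable (fun p I => H p I + K p I) :=
  (PhaseIntegrable.add hH hK).congr fun p I _ => by simp [add_div]

lemma InvIntegrable.const_mul {H : R3 → ℝ → ℝ} (hH : G.InvIntegrable H) (a : ℝ) :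
    G.InvIntegrable (fun p I => a * H p I) :=
  (PhaseIntegrable.const_mul hH a).congr fun p I _ => by simp [mul_div_assoc]

lemma InvIntegrable.sub {H K : R3 → ℝ → ℝ} (hH : G.InvIntegrable H)
    (hK : G.InvIntegrable K) : G.InvIntegrable (fun p I => H p I - K p I) :=
  (hH.add (hK.const_mul (-1))).congr fun p I _ => by ring

lemma phaseInt_add {H K : R3 → ℝ → ℝ} (hH : G.PhaseIntegrable H)
    (hK : G.PhaseIntegrable K) :
    G.phaseInt (fun p I => H p I + K p I) = G.phaseInt H + G.phaseInt K := by
  unfold phaseInt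
  rw [← integral_add hH hK]
  exact integral_congr_ae (.of_forall fun z => by simp [add_mul])

lemma phaseInt_const_mul (H : R3 → ℝ → ℝ) (a : ℝ) :
    G.phaseInt (fun p I => a * H p I) = a * G.phaseInt H := by
  unfold phaseInt
  rw [← integral_const_mul]
  exact integral_congr_ae (.of_forall fun z => by simp [mul_assoc])

lemma invInt_add {H K : R3 → ℝ → ℝ} (hH : G.InvIntegrable H)
    (hK : G.InvIntegrable K) :
    G.invInt (fun p I => H p I + K p I) = G.invInt H + G.invInt K := by
  simp only [invInt, ← phaseInt_add hH hK, add_div]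

lemma invInt_const_mul (H : R3 → ℝ → ℝ) (a : ℝ) :
    G.invInt (fun p I => a * H p I) = a * G.invInt H := by
  simp only [invInt, ← phaseInt_const_mul, mul_div_assoc]

lemma invInt_sub {H K : R3 → ℝ → ℝ} (hH : G.InvIntegrable H)
    (hK : G.InvIntegrable K) :
    G.invInt (fun p I => H p I - K p I) = G.invInt H - G.invInt K := by
  have := invInt_add hH (hK.const_mul (-1))
  rw [invInt_const_mul] at this
  rw [sub_eq_add_neg, ← neg_one_mul, ← this]
  exact G.invInt_congr fun p I _ => by ring

/-- Linear forms of the momentum are integrated component by component. -/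
lemma invInt_linear {H : R3 → ℝ → ℝ}
    (hH : ∀ μ, G.InvIntegrable fun p I => G.fourMom p μ * H p I) (ℓ : (Fin 4 → ℝ) →ₗ[ℝ] ℝ) :
    G.invInt (fun p I => ℓ (G.fourMom p) * H p I) =
      ℓ (fun μ => G.invInt (fun p I => G.fourMom p μ * H p I)) := by
  have h : ∀ x, ℓ x = x 0 * ℓ (Pi.single 0 1) + x 1 * ℓ (Pi.single 1 1) +
      x 2 * ℓ (Pi.single 2 1) + x 3 * ℓ (Pi.single 3 1) := by
    intro x
    conv_lhs => rw [pi_eq_sum_univ' x]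
    simp [Fin.sum_univ_four]
  rw [h]
  simp only [mul_comm _ (ℓ _), ← invInt_const_mul]
  have hI := fun μ => (hH μ).const_mul (ℓ (Pi.single μ 1))
  rw [← invInt_add (hI 0) (hI 1), ← invInt_add ((hI 0).add (hI 1)) (hI 2),
    ← invInt_add (((hI 0).add (hI 1)).add (hI 2)) (hI 3)]
  exact G.invInt_congr fun p I _ => by rw [h]; ring

lemma InvIntegrable.linear {H : R3 → ℝ → ℝ}
    (hH : ∀ μ, G.InvIntegrable fun p I => G.fourMom p μ * H p I) (ℓ : (Fin 4 → ℝ) →ₗ[ℝ] ℝ) :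
    G.InvIntegrable (fun p I => ℓ (G.fourMom p) * H p I) := by
  have h : ∀ x, ℓ x = x 0 * ℓ (Pi.single 0 1) + x 1 * ℓ (Pi.single 1 1) +
      x 2 * ℓ (Pi.single 2 1) + x 3 * ℓ (Pi.single 3 1) := by
    intro x
    conv_lhs => rw [pi_eq_sum_univ' x]
    simp [Fin.sum_univ_four]
  have hI := fun μ => (hH μ).const_mul (ℓ (Pi.single μ 1))
  exact ((((hI 0).add (hI 1)).add (hI 2)).add (hI 3)).congr fun p I _ => by rw [h (G.fourMom p)]; ring

/-! ### Invariance of `dp/p⁰` under boosts -/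

/-- Change of variables with Jacobian `p⁰(Λp)/p⁰(p)`. This is the invariance of `dp/p⁰`, in a form
that yields both integrability and values of integrals. -/
lemma measurePreserving_boost (hG : G.Admissible) (u : R3) :
    MeasurePreserving (G.boost u)
      ((volume : Measure R3).withDensity
        fun p => ENNReal.ofReal (G.p0 (G.boost u p) / G.p0 p)) volume := by
  refine ⟨(G.continuous_boost u).measurable, ?_⟩
  have h := map_withDensity_abs_det_fderiv_eq_addHaar (volume : Measure R3) (s := univ)
    MeasurableSet.univ.nullMeasurableSet
    (fun p _ => (G.hasFDerivAt_boost hG u p).hasFDerivWithinAt)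
    (G.boostHomeo u).injective.injOn
  rw [image_univ, (show Function.Surjective (G.boost u) from (G.boostHomeo u).surjective).range_eq,
    Measure.restrict_univ] at h
  simpa only [G.det_boostDeriv hG, abs_of_nonneg (div_nonneg (G.p0_nonneg _) (G.p0_nonneg _))]
    using h

lemma measurable_boostDensity (u : R3) :
    Measurable fun p => ENNReal.ofReal (G.p0 (G.boost u p) / G.p0 p) := by
  have h1 := (G.continuous_p0.comp (G.continuous_boost u)).measurable
  exact (h1.div G.continuous_p0.measurable).ennreal_ofReal

lemma measurable_boostDensity_fst (u : R3) :
    Measurable fun z : R3 × ℝ => ENNReal.ofReal (G.p0 (G.boost u z.1) / G.p0 z.1) :=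
  (measurable_boostDensity u).comp measurable_fst

lemma measurePreserving_boost_vol (hG : G.Admissible) (u : R3) :
    MeasurePreserving (Prod.map (G.boost u) id)
      (vol.withDensity fun z => ENNReal.ofReal (G.p0 (G.boost u z.1) / G.p0 z.1)) vol := by
  have h := (measurePreserving_boost hG u).prod
    (MeasurePreserving.id ((volume : Measure ℝ).restrict (Ioi 0)))
  rwa [prod_withDensity_left (measurable_boostDensity u)] at h

lemma measurableEmbedding_boost (u : R3) :
    MeasurableEmbedding (Prod.map (G.boost u) id : R3 × ℝ → R3 × ℝ) :=
  (G.boostHomeo u).measurableEmbedding.prodMap MeasurableEmbedding.id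

lemma invIntegrable_boost_iff (hG : G.Admissible) (u : R3) {H : R3 → ℝ → ℝ} :
    G.InvIntegrable (fun p I => H (G.boost u p) I) ↔ G.InvIntegrable H := by
  have h := (measurePreserving_boost_vol hG u).integrable_comp_emb
    (measurableEmbedding_boost u) (g := fun z : R3 × ℝ => H z.1 z.2 / G.p0 z.1 * G.φ z.2)
  unfold InvIntegrable PhaseIntegrable
  rw [← h, integrable_withDensity_iff_integrable_smul'
    (measurable_boostDensity_fst u) (.of_forall fun _ => ENNReal.ofReal_lt_top)]
  refine integrable_congr (.of_forall fun z => ?_)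
  have h1 := hG.p0_pos z.1
  have h2 := hG.p0_pos (G.boost u z.1)
  simp only [Function.comp, Prod.map_fst, Prod.map_snd, id, smul_eq_mul]
  rw [ENNReal.toReal_ofReal (by positivity)]
  field_simp

lemma invInt_boost (hG : G.Admissible) (u : R3) (H : R3 → ℝ → ℝ) :
    G.invInt (fun p I => H (G.boost u p) I) = G.invInt H := by
  have h := (measurePreserving_boost_vol hG u).integral_comp
    (measurableEmbedding_boost u) (fun z : R3 × ℝ => H z.1 z.2 / G.p0 z.1 * G.φ z.2)
  unfold invInt phaseInt
  rw [← h, integral_withDensity_eq_integral_toReal_smul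
    (measurable_boostDensity_fst u) (.of_forall fun _ => ENNReal.ofReal_lt_top)]
  refine integral_congr_ae (.of_forall fun z => ?_)
  have h1 := hG.p0_pos z.1
  have h2 := hG.p0_pos (G.boost u z.1)
  simp only [Prod.map_fst, Prod.map_snd, id, smul_eq_mul]
  rw [ENNReal.toReal_ofReal (by positivity)]
  field_simp

/-! ### Rotations and dilations -/

lemma phaseInt_isometry (A : R3 ≃ₗᵢ[ℝ] R3) (H : R3 → ℝ → ℝ) :
    G.phaseInt (fun p I => H (A p) I) = G.phaseInt H := by
  have h := (A.measurePreserving.prod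
    (MeasurePreserving.id ((volume : Measure ℝ).restrict (Ioi 0)))).integral_comp
    (A.toHomeomorph.measurableEmbedding.prodMap MeasurableEmbedding.id)
    (fun z : R3 × ℝ => H z.1 z.2 * G.φ z.2)
  exact h

/-- Needed because `Z` and `ẽ` are written in the dimensionless momentum `p/(mc)`. -/
lemma phaseInt_smul {r : ℝ} (hr : 0 < r) (H : R3 → ℝ → ℝ) :
    G.phaseInt (fun p I => H (r • p) I) = (r ^ 3)⁻¹ * G.phaseInt H := by
  have hm : Measure.map (Prod.map (fun p : R3 => r • p) (id : ℝ → ℝ)) vol =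
      ENNReal.ofReal (r ^ 3)⁻¹ • vol := by
    rw [vol, ← Measure.map_prod_map _ _ (by fun_prop) measurable_id, Measure.map_id,
      Measure.map_addHaar_smul _ hr.ne', Measure.prod_smul_left, finrank_euclideanSpace_fin,
      abs_of_pos (by positivity)]
  have he : MeasurableEmbedding (Prod.map (fun p : R3 => r • p) (id : ℝ → ℝ)) :=
    (Homeomorph.smulOfNeZero r hr.ne').measurableEmbedding.prodMap MeasurableEmbedding.id
  have h := he.integral_map (μ := vol) (fun z : R3 × ℝ => H z.1 z.2 * G.φ z.2)
  rw [hm, integral_smul_measure, ENNReal.toReal_ofReal (by positivity)] at h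
  exact h.symm

/-- The reflection `p ↦ -p` shows that the integral equals its own negative. -/
lemma phaseInt_coord_mul_radial (i : Fin 3) (g : ℝ → ℝ → ℝ) :
    G.phaseInt (fun p I => p i * g ‖p‖ I) = 0 := by
  have h := phaseInt_isometry (G := G) (LinearIsometryEquiv.neg ℝ) (fun p I => p i * g ‖p‖ I)
  simp only [LinearIsometryEquiv.coe_neg, norm_neg, PiLp.neg_apply, neg_mul] at h
  have h2 := phaseInt_const_mul (G := G) (fun p I => p i * g ‖p‖ I) (-1)
  simp only [neg_one_mul] at h2
  linarith

/-- Reversing the sign of the `i`-th coordinate alone changes the sign of the integrand. -/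
lemma phaseInt_coord_mul_coord_radial {i j : Fin 3} (hij : i ≠ j) (g : ℝ → ℝ → ℝ) :
    G.phaseInt (fun p I => p i * p j * g ‖p‖ I) = 0 := by
  let A : R3 ≃ₗᵢ[ℝ] R3 :=
    LinearIsometryEquiv.piLpCongrRight 2 (fun k => if k = i then .neg ℝ else .refl ℝ ℝ)
  have h := phaseInt_isometry (G := G) A (fun p I => p i * p j * g ‖p‖ I)
  have h1 : ∀ p, A p i = - p i := fun p => by simp [A]
  have h3 : ∀ p, A p j = p j := fun p => by simp [A, hij.symm]
  simp only [A.norm_map, h1, h3, neg_mul] at h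
  have h2 := phaseInt_const_mul (G := G) (fun p I => p i * p j * g ‖p‖ I) (-1)
  simp only [neg_one_mul] at h2
  linarith

/-- Swapping coordinates makes the three diagonal integrals equal, and they sum to the one with
`‖p‖²`. -/
lemma phaseInt_coord_sq_radial (i : Fin 3) (g : ℝ → ℝ → ℝ)
    (hg : ∀ k : Fin 3, G.PhaseIntegrable fun p I => p k * p k * g ‖p‖ I) :
    G.phaseInt (fun p I => p i * p i * g ‖p‖ I) =
      1 / 3 * G.phaseInt (fun p I => ‖p‖ ^ 2 * g ‖p‖ I) := by
  have hs : ∀ k, G.phaseInt (fun p I => p k * p k * g ‖p‖ I) =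
      G.phaseInt (fun p I => p i * p i * g ‖p‖ I) := by
    intro k
    let A : R3 ≃ₗᵢ[ℝ] R3 := LinearIsometryEquiv.piLpCongrLeft 2 ℝ ℝ (Equiv.swap i k)
    have h := phaseInt_isometry (G := G) A (fun p I => p i * p i * g ‖p‖ I)
    have h1 : ∀ p, A p i = p k := fun p => by
      simp [A, LinearIsometryEquiv.piLpCongrLeft_apply, Equiv.piCongrLeft'_apply]
    simpa only [A.norm_map, h1] using h
  have h : G.phaseInt (fun p I => ‖p‖ ^ 2 * g ‖p‖ I) =
      G.phaseInt (fun p I => p 0 * p 0 * g ‖p‖ I) + G.phaseInt (fun p I => p 1 * p 1 * g ‖p‖ I)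
      + G.phaseInt (fun p I => p 2 * p 2 * g ‖p‖ I) := by
    rw [← phaseInt_add (hg 0) (hg 1), ← phaseInt_add ((hg 0).add (hg 1)) (hg 2)]
    refine G.phaseInt_congr fun p I _ => ?_
    rw [EuclideanSpace.real_norm_sq_eq, Fin.sum_univ_three]
    ring
  rw [h, hs 0, hs 1, hs 2]
  ring

end Gas

/-! ### Integral representations of `K₂` and `K₃` -/

/-- Use `y^(k+1)/(k+1)! ≤ exp y` at `y = z cosh r`. The spare power of `cosh r` is at least `exp r /
2`, which supplies the decay in `r`. -/
lemma cosh_pow_mul_exp_le {z : ℝ} (hz : 0 < z) (k : ℕ) (r : ℝ) :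
    Real.cosh r ^ k * Real.exp (-z * Real.cosh r) ≤
      2 * (k + 1).factorial / z ^ (k + 1) * Real.exp (-r) := by
  have hc := Real.cosh_pos r
  have h1 := Real.pow_div_factorial_le_exp (z * Real.cosh r) (by positivity) (k + 1)
  have h2 : Real.exp r ≤ 2 * Real.cosh r := by
    rw [Real.cosh_eq]
    linarith [Real.exp_pos (-r)]
  rw [neg_mul, Real.exp_neg, Real.exp_neg]
  rw [div_le_iff₀ (by positivity), mul_pow] at h1
  have h3 : z ^ (k + 1) * Real.cosh r ^ k * Real.exp r ≤
      2 * (Real.exp (z * Real.cosh r) * (k + 1).factorial) := by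
    calc _ ≤ z ^ (k + 1) * Real.cosh r ^ k * (2 * Real.cosh r) := by gcongr
      _ = 2 * (z ^ (k + 1) * Real.cosh r ^ (k + 1)) := by ring
      _ ≤ _ := by gcongr
  have he := Real.exp_pos r
  have he' := Real.exp_pos (z * Real.cosh r)
  have hzk : 0 < z ^ (k + 1) := by positivity
  field_simp
  linarith

lemma integrableOn_mul_exp_cosh {z : ℝ} (hz : 0 < z) {h : ℝ → ℝ} (hc : Continuous h) {C : ℝ}
    {k : ℕ} (hC : 0 ≤ C) (hle : ∀ r, 0 < r → |h r| ≤ C * Real.cosh r ^ k) :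
    IntegrableOn (fun r => h r * Real.exp (-z * Real.cosh r)) (Ioi 0) := by
  have hi := ((integrableOn_exp_neg_Ioi 0).const_mul
    (C * (2 * (k + 1).factorial / z ^ (k + 1))))
  refine Integrable.mono' hi (by fun_prop) ?_
  filter_upwards [ae_restrict_mem measurableSet_Ioi] with r hr
  rw [norm_mul, Real.norm_eq_abs, Real.norm_eq_abs, Real.abs_exp]
  calc _ ≤ C * Real.cosh r ^ k * Real.exp (-z * Real.cosh r) := by gcongr; exact hle r hr
    _ ≤ _ := by
      rw [mul_assoc, mul_assoc C]
      exact mul_le_mul_of_nonneg_left (cosh_pow_mul_exp_le hz k r) hC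

lemma tendsto_mul_exp_cosh {z : ℝ} (hz : 0 < z) {h : ℝ → ℝ} {C : ℝ} {k : ℕ} (hC : 0 ≤ C)
    (hle : ∀ r, 0 < r → |h r| ≤ C * Real.cosh r ^ k) :
    Filter.Tendsto (fun r => h r * Real.exp (-z * Real.cosh r)) Filter.atTop (𝓝 0) := by
  have ht : Filter.Tendsto (fun r : ℝ => C * (2 * (k + 1).factorial / z ^ (k + 1)) * Real.exp (-r))
      Filter.atTop (𝓝 0) := by
    simpa using Real.tendsto_exp_neg_atTop_nhds_zero.const_mul
      (C * (2 * (k + 1).factorial / z ^ (k + 1)))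
  refine squeeze_zero_norm' ?_ ht
  filter_upwards [Filter.eventually_gt_atTop 0] with r hr
  rw [norm_mul, Real.norm_eq_abs, Real.norm_eq_abs, Real.abs_exp]
  calc _ ≤ C * Real.cosh r ^ k * Real.exp (-z * Real.cosh r) := by gcongr; exact hle r hr
    _ ≤ _ := by
      rw [mul_assoc, mul_assoc C]
      exact mul_le_mul_of_nonneg_left (cosh_pow_mul_exp_le hz k r) hC

/-- Integration by parts against `exp (-z cosh r)`. -/
lemma integral_deriv_mul_exp_cosh {z : ℝ} (hz : 0 < z) {h h' : ℝ → ℝ}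
    (hd : ∀ r, HasDerivAt h (h' r) r) (hc : Continuous h') (h0 : h 0 = 0) {C : ℝ} {k : ℕ}
    (hC : 0 ≤ C) (hle : ∀ r, 0 < r → |h r| ≤ C * Real.cosh r ^ k)
    (hle' : ∀ r, 0 < r → |h' r| ≤ C * Real.cosh r ^ k) :
    ∫ r in Ioi (0 : ℝ), h' r * Real.exp (-z * Real.cosh r) =
      z * ∫ r in Ioi (0 : ℝ), h r * Real.sinh r * Real.exp (-z * Real.cosh r) := by
  have hcont : Continuous h := continuous_iff_continuousAt.2 fun r => (hd r).continuousAt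
  have hi' := integrableOn_mul_exp_cosh hz hc hC hle'
  -- The factor `sinh r ≤ cosh r` raises the growth exponent by one.
  have hi := integrableOn_mul_exp_cosh hz (h := fun r => h r * Real.sinh r) (by fun_prop) hC
    (k := k + 1) (fun r hr => by
      rw [abs_mul, pow_succ, ← mul_assoc]
      have := Real.sinh_lt_cosh r
      rw [abs_of_pos (Real.sinh_pos_iff.2 hr)]
      have h1 := hle r hr
      have h2 := (Real.sinh_pos_iff.2 hr).le
      have h3 := (abs_nonneg _).trans h1
      gcongr)
  have hmain := integral_Ioi_of_hasDerivAt_of_tendsto (a := 0)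
    (f := fun r => h r * Real.exp (-z * Real.cosh r))
    (f' := fun r => h' r * Real.exp (-z * Real.cosh r) -
      z * (h r * Real.sinh r * Real.exp (-z * Real.cosh r))) (m := 0)
    (by fun_prop) (fun r _ => by
      have := (hd r).mul (((Real.hasDerivAt_cosh r).const_mul (-z)).exp)
      refine this.congr_deriv ?_
      ring) (hi'.sub (hi.const_mul z)) (tendsto_mul_exp_cosh hz hC hle)
  rw [integral_sub hi' (hi.const_mul z), integral_const_mul] at hmain
  simp only [h0] at hmain
  linarith

/-- One integration by parts, since `cosh 2r = cosh² r + sinh² r` is the derivative of `sinh r cosh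
r`. -/
lemma besselK_two {z : ℝ} (hz : 0 < z) :
    ∫ r in Ioi (0 : ℝ), Real.sinh r ^ 2 * Real.cosh r * Real.exp (-z * Real.cosh r) =
      besselK 2 z / z := by
  have h := integral_deriv_mul_exp_cosh hz (h := fun r => Real.sinh r * Real.cosh r)
    (h' := fun r => Real.cosh r ^ 2 + Real.sinh r ^ 2) (C := 2) (k := 2)
    (fun r => ((Real.hasDerivAt_sinh r).mul (Real.hasDerivAt_cosh r)).congr_deriv (by ring))
    (by fun_prop) (by simp) (by norm_num)
    (fun r hr => by
      have h1 := Real.sinh_pos_iff.2 hr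
      have h2 := Real.sinh_lt_cosh r
      rw [abs_of_pos (by positivity)]
      nlinarith)
    (fun r hr => by
      rw [abs_of_nonneg (by positivity)]
      linarith [Real.cosh_sq r])
  rw [eq_div_iff hz.ne', mul_comm]
  unfold besselK
  refine Eq.trans ?_ (h.symm.trans ?_)
  · congr 2 with r
    ring
  · congr 1 with r
    push_cast
    rw [Real.cosh_two_mul]

/-- Two integrations by parts. With `f = 3 sinh cosh² + sinh³`, one has `f' = 3 cosh 3r`, while `f
sinh` is the derivative of `sinh³ cosh`. -/
lemma besselK_three {z : ℝ} (hz : 0 < z) :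
    ∫ r in Ioi (0 : ℝ), Real.sinh r ^ 4 * Real.cosh r * Real.exp (-z * Real.cosh r) =
      3 * besselK 3 z / z ^ 2 := by
  have h1 := integral_deriv_mul_exp_cosh hz (h := fun r => Real.sinh r ^ 3 * Real.cosh r)
    (h' := fun r => (3 * Real.sinh r * Real.cosh r ^ 2 + Real.sinh r ^ 3) * Real.sinh r)
    (C := 4) (k := 4)
    (fun r => (((Real.hasDerivAt_sinh r).pow 3).mul (Real.hasDerivAt_cosh r)).congr_deriv
      (by simp only [Pi.pow_apply]; push_cast; ring))
    (by fun_prop) (by simp) (by norm_num)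
    (fun r hr => by
      have h1 := Real.sinh_pos_iff.2 hr
      have h2 := (Real.sinh_lt_cosh r).le
      rw [abs_of_pos (by positivity)]
      have : Real.sinh r ^ 3 * Real.cosh r ≤ Real.cosh r ^ 3 * Real.cosh r := by gcongr
      have : 0 < Real.cosh r ^ 4 := by positivity
      linarith)
    (fun r hr => by
      have h1 := Real.sinh_pos_iff.2 hr
      have h2 := (Real.sinh_lt_cosh r).le
      rw [abs_of_pos (by positivity)]
      calc _ ≤ (3 * Real.cosh r * Real.cosh r ^ 2 + Real.cosh r ^ 3) * Real.cosh r := by gcongr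
        _ = _ := by ring)
  have h2 := integral_deriv_mul_exp_cosh hz
    (h := fun r => 3 * Real.sinh r * Real.cosh r ^ 2 + Real.sinh r ^ 3)
    (h' := fun r => 3 * (4 * Real.cosh r ^ 3 - 3 * Real.cosh r))
    -- `21 = 12 + 9` bounds `12 cosh³ - 9 cosh` crudely; the primitive itself needs only `4`.
    (C := 21) (k := 3)
    (fun r => by
      refine ((((Real.hasDerivAt_sinh r).const_mul 3).mul ((Real.hasDerivAt_cosh r).pow 2)).add
        ((Real.hasDerivAt_sinh r).pow 3)).congr_deriv ?_
      have := Real.cosh_sq r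
      simp only [Pi.pow_apply]
      push_cast
      linear_combination (- 9 * Real.cosh r) * this)
    (by fun_prop) (by simp) (by norm_num)
    (fun r hr => by
      have h1 := Real.sinh_pos_iff.2 hr
      have h2 := (Real.sinh_lt_cosh r).le
      rw [abs_of_pos (by positivity)]
      calc _ ≤ 3 * Real.cosh r * Real.cosh r ^ 2 + Real.cosh r ^ 3 := by gcongr
        _ ≤ _ := by nlinarith [pow_pos (Real.cosh_pos r) 3])
    (fun r hr => by
      have h1 := Real.one_le_cosh r
      have h2 : Real.cosh r ≤ Real.cosh r ^ 3 := le_self_pow₀ h1 (by norm_num)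
      rw [abs_le]
      constructor <;> linarith)
  have h3 : 3 * besselK 3 z = z * (z * ∫ r in Ioi (0 : ℝ),
      Real.sinh r ^ 3 * Real.cosh r * Real.sinh r * Real.exp (-z * Real.cosh r)) := by
    rw [← h1, ← h2, besselK, ← integral_const_mul]
    congr 1 with r
    push_cast
    rw [Real.cosh_three_mul]
    ring
  rw [h3, eq_div_iff (by positivity), sq, mul_comm, mul_assoc]
  congr 3
  congr 1 with r
  ring

/-! ### Integrals of radial functions -/

lemma image_mul_sinh {M : ℝ} (hM : 0 < M) :
    (fun s => M * Real.sinh s) '' Ioi 0 = Ioi 0 := by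
  ext r
  simp only [mem_image, mem_Ioi]
  constructor
  · rintro ⟨s, hs, rfl⟩
    exact mul_pos hM (Real.sinh_pos_iff.2 hs)
  · intro hr
    refine ⟨Real.arsinh (r / M), Real.arsinh_pos_iff.2 (by positivity), ?_⟩
    rw [Real.sinh_arsinh]
    field_simp

/-- The area `4π` of the unit sphere. -/
def sphereArea : ℝ := 3 * (volume : Measure R3).real (Metric.ball 0 1)

lemma sphereArea_pos : 0 < sphereArea :=
  mul_pos (by norm_num) (ENNReal.toReal_pos (Metric.measure_ball_pos _ _ one_pos).ne'
    measure_ball_lt_top.ne)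

/-- Polar coordinates, then `r = M sinh s`, which turns `√(M² + r²)` into `M cosh s` and so leads to
Bessel integrals. -/
lemma integral_radial {M : ℝ} (hM : 0 < M) (f : ℝ → ℝ) :
    ∫ p : R3, f ‖p‖ = sphereArea * ∫ s in Ioi (0 : ℝ),
      M * Real.cosh s * ((M * Real.sinh s) ^ 2 * f (M * Real.sinh s)) := by
  rw [integral_fun_norm_addHaar, finrank_euclideanSpace_fin, sphereArea, nsmul_eq_mul, smul_eq_mul,
    Nat.cast_ofNat, ← mul_assoc]
  congr 1
  have h := integral_image_eq_integral_abs_deriv_smul (s := Ioi (0 : ℝ))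
    (f := fun s => M * Real.sinh s) (f' := fun s => M * Real.cosh s) measurableSet_Ioi
    (fun s _ => ((Real.hasDerivAt_sinh s).const_mul M).hasDerivWithinAt)
    (fun s _ t _ hst => Real.sinh_injective (mul_left_cancel₀ hM.ne' hst))
    (fun r => r ^ 2 * f r)
  rw [image_mul_sinh hM] at h
  simp only [Nat.reduceSub, smul_eq_mul]
  rw [h]
  congr 1 with s
  rw [abs_of_pos (mul_pos hM (Real.cosh_pos s)), smul_eq_mul]

namespace Gas

variable {G : Gas}

lemma sqrt_sinh {M : ℝ} (hM : 0 < M) (s : ℝ) :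
    Real.sqrt (M ^ 2 + (M * Real.sinh s) ^ 2) = M * Real.cosh s := by
  have := Real.cosh_pos s
  rw [Real.sqrt_eq_iff_eq_sq (by positivity) (by positivity)]
  linear_combination (-M ^ 2) * Real.cosh_sq s

lemma integral_exp_p0 (hG : G.Admissible) {z : ℝ} (hz : 0 < z) :
    ∫ p : R3, Real.exp (-z * (G.p0 p / (G.m * G.c))) =
      sphereArea * (G.m * G.c) ^ 3 * (besselK 2 z / z) := by
  have hM := hG.mc_pos
  rw [← besselK_two hz, mul_assoc, ← integral_const_mul]
  refine (integral_radial hM fun r =>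
    Real.exp (-z * (Real.sqrt ((G.m * G.c) ^ 2 + r ^ 2) / (G.m * G.c)))).trans ?_
  congr 2 with s
  rw [sqrt_sinh hM, mul_div_cancel_left₀ _ hM.ne']
  ring

lemma integral_norm_sq_exp_p0 (hG : G.Admissible) {z : ℝ} (hz : 0 < z) :
    ∫ p : R3, ‖p‖ ^ 2 * Real.exp (-z * (G.p0 p / (G.m * G.c))) =
      sphereArea * (G.m * G.c) ^ 5 * (3 * besselK 3 z / z ^ 2) := by
  have hM := hG.mc_pos
  rw [← besselK_three hz, mul_assoc, ← integral_const_mul]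
  refine (integral_radial hM fun r =>
    r ^ 2 * Real.exp (-z * (Real.sqrt ((G.m * G.c) ^ 2 + r ^ 2) / (G.m * G.c)))).trans ?_
  congr 2 with s
  rw [sqrt_sinh hM, mul_div_cancel_left₀ _ hM.ne']
  ring

end Gas

namespace Gas

variable {G : Gas}

/-! ### Integrability of the Boltzmann factor and its moments -/

lemma Admissible.one_le_w (hG : G.Admissible) {I : ℝ} (hI : 0 < I) : 1 ≤ G.w I := by
  have := hG.m_pos
  have := hG.c_pos
  exact le_add_of_nonneg_right (by positivity)

lemma Admissible.w_pos (hG : G.Admissible) {I : ℝ} (hI : 0 < I) : 0 < G.w I :=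
  one_pos.trans_le (hG.one_le_w hI)

@[fun_prop]
lemma continuous_w : Continuous G.w := by unfold w; fun_prop

@[fun_prop]
lemma continuous_fourMom : Continuous G.fourMom := by
  refine continuous_pi fun μ => ?_
  refine Fin.cases ?_ (fun i => ?_) μ
  · exact G.continuous_p0
  · simp only [fourMom_succ]
    fun_prop

@[fun_prop]
lemma continuous_mink (v : Fin 4 → ℝ) : Continuous (mink v) := by unfold mink; fun_prop

variable (G) in
/-- The Boltzmann factor `exp (-β (1 + I/(mc²)) p⁰)` of a gas at rest. -/
def boltzmann (β : ℝ) (p : R3) (I : ℝ) : ℝ := Real.exp (-β * G.w I * G.p0 p)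

lemma boltzmann_pos (β : ℝ) (p : R3) (I : ℝ) : 0 < G.boltzmann β p I := Real.exp_pos _

@[fun_prop]
lemma continuous_boltzmann (β : ℝ) : Continuous fun z : R3 × ℝ => G.boltzmann β z.1 z.2 := by
  unfold boltzmann
  fun_prop

lemma phaseIntegrable_of_abs_le (hG : G.Admissible) {β : ℝ} (hβ : 0 < β) {H : R3 → ℝ → ℝ}
    (hH : Measurable fun z : R3 × ℝ => H z.1 z.2) (C : ℝ) (k l : ℕ)
    (hle : ∀ p I, 0 < I → |H p I| ≤ C * (G.p0 p ^ k * G.w I ^ l * G.boltzmann β p I)) :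
    G.PhaseIntegrable H := by
  -- The polynomial is `(p⁰)^k (1 + I/(mc²))^l`, that is, `(p⁰)^k w^l`.
  have h := (hG.φ_decay β hβ (MvPolynomial.X 0 ^ k *
    (1 + MvPolynomial.C (1 / (G.m * G.c ^ 2)) * MvPolynomial.X 1) ^ l)).const_mul C
  refine Integrable.mono' h (hH.mul (hG.φ_measurable.comp measurable_snd)).aestronglyMeasurable ?_
  filter_upwards [ae_vol_pos] with z hz
  have hφ := hG.φ_nonneg z.2 hz
  rw [norm_mul, Real.norm_eq_abs, Real.norm_eq_abs, abs_of_nonneg hφ]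
  refine mul_le_mul_of_nonneg_right ((hle z.1 z.2 hz).trans (le_of_eq ?_)) hφ
  simp [boltzmann, w, div_eq_inv_mul]

/-- Here `F` serves only to show that `φ` is not almost everywhere zero: if the integral of `H`
vanished, so would `φ`, and with it every phase integral. The point `p = 0` is excluded so that the
weight `‖p‖²` is allowed. -/
lemma phaseInt_pos (hG : G.Admissible) {F H : R3 → ℝ → ℝ} (hF : G.phaseInt F ≠ 0)
    (hH : G.PhaseIntegrable H) (hpos : ∀ p I, p ≠ 0 → 0 < I → 0 < H p I) :
    0 < G.phaseInt H := by
  have h0 : 0 ≤ᵐ[vol] fun z : R3 × ℝ => H z.1 z.2 * G.φ z.2 := by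
    filter_upwards [ae_vol_pos, ae_vol_fst_ne_zero] with z hz hz'
    exact mul_nonneg (hpos _ _ hz' hz).le (hG.φ_nonneg _ hz)
  refine lt_of_le_of_ne (integral_nonneg_of_ae h0) fun he => hF ?_
  have h1 := (integral_eq_zero_iff_of_nonneg_ae h0 hH).1 he.symm
  refine integral_eq_zero_of_ae ?_
  filter_upwards [ae_vol_pos, ae_vol_fst_ne_zero, h1] with z hz hz' h
  have h2 : G.φ z.2 = 0 := (mul_eq_zero.1 h).resolve_left (hpos _ _ hz' hz).ne'
  simp [h2]

lemma phaseIntegrable_boltzmann (hG : G.Admissible) {β : ℝ} (hβ : 0 < β) :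
    G.PhaseIntegrable (G.boltzmann β) :=
  phaseIntegrable_of_abs_le hG hβ (by fun_prop) 1 0 0 fun p I _ => by
    simp [abs_of_pos (boltzmann_pos β p I)]

lemma phaseIntegrable_norm_sq_boltzmann (hG : G.Admissible) {β : ℝ} (hβ : 0 < β) :
    G.PhaseIntegrable (fun p I => ‖p‖ ^ 2 * (G.w I ^ 2 * G.boltzmann β p I)) :=
  phaseIntegrable_of_abs_le hG hβ (by fun_prop) 1 2 2 fun p I _ => by
    have := boltzmann_pos (G := G) β p I
    have := G.norm_le_p0 p
    rw [abs_of_nonneg (by positivity), one_mul, mul_assoc]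
    gcongr

/-! ### The thermodynamic functions in terms of Boltzmann moments -/

variable (G) in
/-- The inverse temperature `c / (k_B T)`, the coefficient of `(1 + I/(mc²)) p⁰`. -/
def invTemp (T : ℝ) : ℝ := G.c / (G.kB * T)

lemma invTemp_pos (hG : G.Admissible) {T : ℝ} (hT : 0 < T) : 0 < G.invTemp T :=
  div_pos hG.c_pos (mul_pos hG.kB_pos hT)

lemma γ_pos (hG : G.Admissible) {T : ℝ} (hT : 0 < T) : 0 < G.γ T := by
  have := hG.m_pos
  have := hG.c_pos
  have := hG.kB_pos
  unfold γ
  positivity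

lemma p0_smul (hG : G.Admissible) (p : R3) :
    G.p0 ((G.m * G.c) • p) = G.m * G.c * Real.sqrt (1 + ‖p‖ ^ 2) := by
  have := hG.mc_pos
  rw [p0, norm_smul, Real.norm_eq_abs, abs_of_pos this,
    show (G.m * G.c) ^ 2 + (G.m * G.c * ‖p‖) ^ 2 = (G.m * G.c) ^ 2 * (1 + ‖p‖ ^ 2) by ring,
    Real.sqrt_mul (by positivity), Real.sqrt_sq this.le]

lemma boltzmann_smul (hG : G.Admissible) (T : ℝ) (p : R3) (I : ℝ) :
    G.boltzmann (G.invTemp T) ((G.m * G.c) • p) I =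
      Real.exp (-(G.m * G.c ^ 2 + I) * (1 / (G.kB * T)) * Real.sqrt (1 + ‖p‖ ^ 2)) := by
  have := hG.m_pos.ne'
  have := hG.c_pos.ne'
  rw [boltzmann, p0_smul hG, invTemp, w]
  congr 1
  field_simp

lemma partitionFn_eq (hG : G.Admissible) (T : ℝ) :
    G.partitionFn T = ((G.m * G.c) ^ 3)⁻¹ * G.phaseInt (G.boltzmann (G.invTemp T)) := by
  rw [partitionFn, ← phaseInt_smul hG.mc_pos]
  simp only [boltzmann_smul hG]

lemma eTilde_eq (hG : G.Admissible) (T : ℝ) :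
    G.eTilde T = G.c * G.phaseInt (fun p I => G.p0 p * (G.w I * G.boltzmann (G.invTemp T) p I)) /
      G.phaseInt (G.boltzmann (G.invTemp T)) := by
  have hm := hG.m_pos.ne'
  have hc := hG.c_pos.ne'
  have h2 : G.phaseInt (fun p I => Real.sqrt (1 + ‖p‖ ^ 2) *
        Real.exp (-(G.m * G.c ^ 2 + I) * (1 / (G.kB * T)) * Real.sqrt (1 + ‖p‖ ^ 2)) *
        (G.m * G.c ^ 2 + I)) = ((G.m * G.c) ^ 3)⁻¹ * (G.c * G.phaseInt (fun p I => G.p0 p *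
          (G.w I * G.boltzmann (G.invTemp T) p I))) := by
    rw [← phaseInt_const_mul, ← phaseInt_smul hG.mc_pos]
    refine G.phaseInt_congr fun p I _ => ?_
    rw [p0_smul hG, boltzmann_smul hG, w]
    field_simp
  rw [eTilde, h2, partitionFn_eq hG, mul_div_mul_left]
  positivity

lemma boltzmann_eq (hG : G.Admissible) (T : ℝ) (p : R3) (I : ℝ) :
    G.boltzmann (G.invTemp T) p I =
      Real.exp (-(G.γ T * G.w I) * (G.p0 p / (G.m * G.c))) := by
  have := hG.m_pos.ne'
  have := hG.c_pos.ne'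
  rw [boltzmann, invTemp, γ]
  congr 1
  field_simp

lemma phaseInt_eq_integral_integral {H : R3 → ℝ → ℝ} (hH : G.PhaseIntegrable H) :
    G.phaseInt H = ∫ I in Ioi (0 : ℝ), (∫ p : R3, H p I) * G.φ I := by
  unfold phaseInt vol
  rw [integral_prod_symm _ hH]
  simp only [integral_mul_const]

lemma phaseInt_boltzmann (hG : G.Admissible) {T : ℝ} (hT : 0 < T) :
    G.phaseInt (G.boltzmann (G.invTemp T)) = sphereArea * (G.m * G.c) ^ 3 *
      ∫ I in Ioi (0 : ℝ), besselK 2 (G.γ T * G.w I) / (G.γ T * G.w I) * G.φ I := by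
  rw [phaseInt_eq_integral_integral (phaseIntegrable_boltzmann hG (invTemp_pos hG hT)),
    ← integral_const_mul]
  refine setIntegral_congr_fun measurableSet_Ioi fun I hI => ?_
  simp only [boltzmann_eq hG, integral_exp_p0 hG (mul_pos (γ_pos hG hT) (hG.w_pos hI)), mul_assoc]

lemma phaseInt_norm_sq_boltzmann (hG : G.Admissible) {T : ℝ} (hT : 0 < T) :
    G.phaseInt (fun p I => ‖p‖ ^ 2 * (G.w I ^ 2 * G.boltzmann (G.invTemp T) p I)) =
      3 * sphereArea * (G.m * G.c) ^ 5 / G.γ T ^ 2 *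
        ∫ I in Ioi (0 : ℝ), besselK 3 (G.γ T * G.w I) * G.φ I := by
  rw [phaseInt_eq_integral_integral (phaseIntegrable_norm_sq_boltzmann hG (invTemp_pos hG hT)),
    ← integral_const_mul]
  refine setIntegral_congr_fun measurableSet_Ioi fun I hI => ?_
  have hw := hG.w_pos hI
  have hγ := γ_pos hG hT
  have h := integral_norm_sq_exp_p0 hG (mul_pos hγ hw)
  simp only [mul_left_comm _ (G.w I ^ 2), integral_const_mul, boltzmann_eq hG, h]
  field_simp

/-- The meaning of the Bessel quotient: `b` is, up to `n/(3m)`, the mean of `|p|² w²` under the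
Boltzmann factor. The sphere area cancels. -/
lemma b_eq (hG : G.Admissible) (F : R3 → ℝ → ℝ) {T : ℝ} (hT : 0 < T) :
    G.b F T = G.numDensity F / (3 * G.m * G.phaseInt (G.boltzmann (G.invTemp T))) *
      G.phaseInt (fun p I => ‖p‖ ^ 2 * (G.w I ^ 2 * G.boltzmann (G.invTemp T) p I)) := by
  rw [phaseInt_norm_sq_boltzmann hG hT, phaseInt_boltzmann hG hT, b]
  have := hG.m_pos
  have := hG.c_pos
  have := γ_pos hG hT
  have := sphereArea_pos
  generalize ∫ I in Ioi (0 : ℝ), besselK 2 (G.γ T * G.w I) / (G.γ T * G.w I) * G.φ I = x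
  -- If the `K₂` integral vanishes, both sides are `0` by the convention for division by zero.
  rcases eq_or_ne x 0 with rfl | hx
  · simp
  · field_simp

end Gas

namespace Gas

variable {G : Gas}

/-! ### Moments of the modified equilibrium in its rest frame -/

/-- The exponent `k + 1` loses one power to the denominator of `dp/p⁰`. -/
lemma invIntegrable_mul_boltzmann (hG : G.Admissible) {β : ℝ} (hβ : 0 < β) {K : R3 → ℝ}
    (hK : Measurable K) (k l : ℕ) (hle : ∀ p, |K p| ≤ G.p0 p ^ (k + 1)) :
    G.InvIntegrable (fun p I => K p * (G.w I ^ l * G.boltzmann β p I)) := by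
  refine phaseIntegrable_of_abs_le hG hβ ?_ 1 k l fun p I hI => ?_
  · fun_prop
  · have hp := hG.p0_pos p
    have hw := hG.w_pos hI
    have hb := boltzmann_pos (G := G) β p I
    rw [abs_div, abs_mul, abs_of_pos hp, abs_of_pos (by positivity : 0 < _ * G.boltzmann β p I),
      div_le_iff₀ hp]
    calc _ ≤ G.p0 p ^ (k + 1) * (G.w I ^ l * G.boltzmann β p I) := by gcongr; exact hle p
      _ = _ := by ring

lemma invIntegrable_fourMom_boltzmann (hG : G.Admissible) {β : ℝ} (hβ : 0 < β) (l : ℕ)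
    (μ : Fin 4) :
    G.InvIntegrable (fun p I => G.fourMom p μ * (G.w I ^ l * G.boltzmann β p I)) :=
  invIntegrable_mul_boltzmann hG hβ (by fun_prop) 0 l fun p => by
    simpa using G.abs_fourMom_le p μ

lemma invIntegrable_fourMom_two_boltzmann (hG : G.Admissible) {β : ℝ} (hβ : 0 < β) (l : ℕ)
    (μ ν : Fin 4) :
    G.InvIntegrable (fun p I =>
      G.fourMom p μ * (G.fourMom p ν * (G.w I ^ l * G.boltzmann β p I))) :=
  (invIntegrable_mul_boltzmann hG hβ (K := fun p => G.fourMom p μ * G.fourMom p ν) (by fun_prop)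
    1 l fun p => by
      rw [abs_mul, pow_two]
      exact mul_le_mul (G.abs_fourMom_le p μ) (G.abs_fourMom_le p ν) (abs_nonneg _)
        (G.p0_nonneg p)).congr fun p I _ => by ring

lemma invIntegrable_fourMom_three_boltzmann (hG : G.Admissible) {β : ℝ} (hβ : 0 < β) (l : ℕ)
    (μ ν κ : Fin 4) :
    G.InvIntegrable (fun p I => G.fourMom p μ *
      (G.fourMom p ν * (G.fourMom p κ * (G.w I ^ l * G.boltzmann β p I)))) :=
  (invIntegrable_mul_boltzmann hG hβ
    (K := fun p => G.fourMom p μ * (G.fourMom p ν * G.fourMom p κ)) (by fun_prop)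
    2 l fun p => by
      rw [abs_mul, abs_mul, pow_succ', pow_two]
      have h0 := G.p0_nonneg p
      have := G.abs_fourMom_le p
      gcongr <;> apply this).congr fun p I _ => by ring

variable (G) in
/-- The distribution `(1 - q_μ p^μ (1 + I/(mc²)) D) a exp (-β (1 + I/(mc²)) p⁰)`. -/
def restMod (a D β : ℝ) (q : Fin 4 → ℝ) (p : R3) (I : ℝ) : ℝ :=
  (1 - mink q (G.fourMom p) * (G.w I * D)) * (a * G.boltzmann β p I)

lemma invIntegrable_fourMom_restMod (hG : G.Admissible) {β : ℝ} (hβ : 0 < β) (a D : ℝ)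
    (q : Fin 4 → ℝ) (μ : Fin 4) :
    G.InvIntegrable (fun p I => G.fourMom p μ * G.restMod a D β q p I) :=
  (((invIntegrable_fourMom_boltzmann hG hβ 0 μ).const_mul a).sub
    ((InvIntegrable.linear (fun κ => invIntegrable_fourMom_two_boltzmann hG hβ 1 κ μ)
      (minkLin q)).const_mul (a * D))).congr fun p I _ => by
    simp only [restMod, minkLin_apply]
    ring

lemma invIntegrable_fourMom_two_restMod (hG : G.Admissible) {β : ℝ} (hβ : 0 < β) (a D : ℝ)
    (q : Fin 4 → ℝ) (μ ν : Fin 4) :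
    G.InvIntegrable (fun p I =>
      G.fourMom p μ * (G.fourMom p ν * (G.restMod a D β q p I * G.w I))) :=
  (((invIntegrable_fourMom_two_boltzmann hG hβ 1 μ ν).const_mul a).sub
    ((InvIntegrable.linear (fun κ => invIntegrable_fourMom_three_boltzmann hG hβ 2 κ μ ν)
      (minkLin q)).const_mul (a * D))).congr fun p I _ => by
    simp only [restMod, minkLin_apply]
    ring

lemma invInt_p0_mul (hG : G.Admissible) (H : R3 → ℝ → ℝ) :
    G.invInt (fun p I => G.p0 p * H p I) = G.phaseInt H :=
  G.phaseInt_congr fun p _ _ => mul_div_cancel_left₀ _ (hG.p0_pos p).ne'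

lemma mink_eq_zero_of_spatial {q x : Fin 4 → ℝ} (hq : q 0 = 0) (hx : ∀ i : Fin 3, x i.succ = 0) :
    mink q x = 0 := by
  simp [mink, hq, hx]

/-- As `q` is spatial, the correction is a sum of terms `pⁱ` times a radial function, hence odd. -/
lemma invInt_p0_restMod (hG : G.Admissible) {β : ℝ} (hβ : 0 < β) (a D : ℝ)
    {q : Fin 4 → ℝ} (hq : q 0 = 0) :
    G.invInt (fun p I => G.p0 p * G.restMod a D β q p I) = a * G.phaseInt (G.boltzmann β) := by
  have h2 := fun κ => invIntegrable_fourMom_two_boltzmann hG hβ 1 κ 0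
  have hz : mink q (fun κ => G.invInt (fun p I =>
      G.fourMom p κ * (G.fourMom p 0 * (G.w I ^ 1 * G.boltzmann β p I)))) = 0 := by
    refine mink_eq_zero_of_spatial hq fun i => ?_
    rw [← phaseInt_coord_mul_radial (G := G) i (fun r I => G.w I ^ 1 *
      Real.exp (-β * G.w I * Real.sqrt ((G.m * G.c) ^ 2 + r ^ 2))), ← invInt_p0_mul hG]
    exact G.invInt_congr fun p I _ => by
      simp only [fourMom_zero, fourMom_succ, boltzmann, p0]; ring
  have h := invInt_sub ((invIntegrable_fourMom_boltzmann hG hβ 0 0).const_mul a)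
    ((InvIntegrable.linear h2 (minkLin q)).const_mul (a * D))
  rw [invInt_const_mul, invInt_const_mul, invInt_linear h2, minkLin_apply, hz, mul_zero,
    sub_zero] at h
  rw [← invInt_p0_mul hG]
  refine Eq.trans (G.invInt_congr fun p I _ => ?_) (h.trans ?_)
  · simp only [restMod, minkLin_apply, fourMom_zero]
    ring
  · simp

/-- By parity, the equilibrium part reaches only the time component and the correction only the
spatial ones. By isotropy the latter see `δ_ij |p|²/3`, so the result is parallel to `q`. -/
lemma invInt_p0_fourMom_restMod (hG : G.Admissible) {β : ℝ} (hβ : 0 < β) (a D : ℝ)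
    {q : Fin 4 → ℝ} (hq : q 0 = 0) :
    (fun μ => G.invInt (fun p I => G.fourMom p μ * (G.p0 p * (G.restMod a D β q p I * G.w I)))) =
      (a * G.phaseInt (fun p I => G.p0 p * (G.w I * G.boltzmann β p I))) • timeAxis +
      (a * D * (1 / 3 * G.phaseInt (fun p I => ‖p‖ ^ 2 * (G.w I ^ 2 * G.boltzmann β p I)))) • q := by
  have hmain : ∀ μ, G.invInt (fun p I =>
      G.fourMom p μ * (G.p0 p * (G.restMod a D β q p I * G.w I))) =
      a * G.invInt (fun p I => G.fourMom p μ * (G.fourMom p 0 *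
        (G.w I ^ 1 * G.boltzmann β p I))) -
      a * D * mink q (fun κ => G.invInt (fun p I => G.fourMom p κ * (G.fourMom p μ *
        (G.fourMom p 0 * (G.w I ^ 2 * G.boltzmann β p I))))) := by
    intro μ
    have h3 := fun κ => invIntegrable_fourMom_three_boltzmann hG hβ 2 κ μ 0
    have h := invInt_sub ((invIntegrable_fourMom_two_boltzmann hG hβ 1 μ 0).const_mul a)
      ((InvIntegrable.linear h3 (minkLin q)).const_mul (a * D))
    rw [invInt_const_mul, invInt_const_mul, invInt_linear h3, minkLin_apply] at h
    rw [← h]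
    refine G.invInt_congr fun p I _ => ?_
    simp only [restMod, minkLin_apply, fourMom_zero]
    ring
  ext μ
  rw [hmain]
  refine Fin.cases ?_ (fun i => ?_) μ
  · rw [mink_eq_zero_of_spatial hq]
    · simp [timeAxis, hq, invInt_p0_mul hG]
    · intro i
      rw [← phaseInt_coord_mul_radial (G := G) i (fun r I =>
        Real.sqrt ((G.m * G.c) ^ 2 + r ^ 2) * (G.w I ^ 2 *
        Real.exp (-β * G.w I * Real.sqrt ((G.m * G.c) ^ 2 + r ^ 2)))), ← invInt_p0_mul hG]
      exact G.invInt_congr fun p I _ => by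
        simp only [fourMom_zero, fourMom_succ, boltzmann, p0]; ring
  · have h1 : G.invInt (fun p I => G.fourMom p i.succ * (G.fourMom p 0 *
        (G.w I ^ 1 * G.boltzmann β p I))) = 0 := by
      rw [← phaseInt_coord_mul_radial (G := G) i (fun r I => G.w I ^ 1 *
        Real.exp (-β * G.w I * Real.sqrt ((G.m * G.c) ^ 2 + r ^ 2))), ← invInt_p0_mul hG]
      exact G.invInt_congr fun p I _ => by
        simp only [fourMom_zero, fourMom_succ, boltzmann, p0]; ring
    have h2 : ∀ j : Fin 3, G.invInt (fun p I => G.fourMom p j.succ * (G.fourMom p i.succ *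
        (G.fourMom p 0 * (G.w I ^ 2 * G.boltzmann β p I)))) =
        G.phaseInt (fun p I => p j * p i * (G.w I ^ 2 *
          Real.exp (-β * G.w I * Real.sqrt ((G.m * G.c) ^ 2 + ‖p‖ ^ 2)))) := by
      intro j
      rw [← invInt_p0_mul hG]
      exact G.invInt_congr fun p I _ => by
        simp only [fourMom_zero, fourMom_succ, boltzmann, p0]; ring
    have h3 : ∀ j : Fin 3, j ≠ i → G.phaseInt (fun p I => p j * p i * (G.w I ^ 2 *
          Real.exp (-β * G.w I * Real.sqrt ((G.m * G.c) ^ 2 + ‖p‖ ^ 2)))) = 0 := fun j hj =>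
      phaseInt_coord_mul_coord_radial hj (fun r I => G.w I ^ 2 *
          Real.exp (-β * G.w I * Real.sqrt ((G.m * G.c) ^ 2 + r ^ 2)))
    have h4 := phaseInt_coord_sq_radial (G := G) i (fun r I => G.w I ^ 2 *
          Real.exp (-β * G.w I * Real.sqrt ((G.m * G.c) ^ 2 + r ^ 2))) (fun k =>
      phaseIntegrable_of_abs_le hG hβ (by fun_prop) 1 2 2 fun p I hI => by
        have hp := PiLp.norm_apply_le p k
        rw [Real.norm_eq_abs] at hp
        have hp2 := hp.trans (G.norm_le_p0 p)
        have := hG.w_pos hI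
        have := G.p0_nonneg p
        have hb := boltzmann_pos (G := G) β p I
        have he : |p k * p k * (G.w I ^ 2 *
            Real.exp (-β * G.w I * Real.sqrt ((G.m * G.c) ^ 2 + ‖p‖ ^ 2)))| =
            |p k| * |p k| * (G.w I ^ 2 * G.boltzmann β p I) := by
          rw [abs_mul, abs_mul, abs_of_pos (by positivity : 0 < G.w I ^ 2 * Real.exp _)]
          rfl
        rw [he]
        calc _ ≤ G.p0 p * G.p0 p * (G.w I ^ 2 * G.boltzmann β p I) := by gcongr
          _ = _ := by ring)
    -- The minus sign of the spatial metric cancels the one in `1 - q_μ p^μ w D`.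
    have h5 : mink q (fun κ => G.invInt (fun p I => G.fourMom p κ * (G.fourMom p i.succ *
        (G.fourMom p 0 * (G.w I ^ 2 * G.boltzmann β p I))))) = -(q i.succ *
        (1 / 3 * G.phaseInt (fun p I => ‖p‖ ^ 2 * (G.w I ^ 2 * G.boltzmann β p I)))) := by
      simp only [mink, hq, h2, zero_mul, zero_sub]
      rw [Finset.sum_eq_single i (fun j _ hj => by rw [h3 j hj, mul_zero]) (by simp)]
      simp only [h4]
      rfl
    rw [h1, h5]
    simp [timeAxis]
    ring

end Gas

namespace Gas

variable {G : Gas}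

/-! ### The Eckart frame of a distribution function -/

lemma PhaseIntegrable.bdd_mul {H K : R3 → ℝ → ℝ} (hH : G.PhaseIntegrable H)
    (hK : Measurable fun z : R3 × ℝ => K z.1 z.2) (C : ℝ) (hC : ∀ p I, 0 < I → |K p I| ≤ C) :
    G.PhaseIntegrable (fun p I => K p I * H p I) := by
  have h := Integrable.bdd_mul (c := C) hH hK.aestronglyMeasurable
    (ae_vol_pos.mono fun z hz => hC z.1 z.2 hz)
  exact h.congr (.of_forall fun z => by simp [mul_assoc])

lemma invIntegrable_fourMom_mul (hG : G.Admissible) {F : R3 → ℝ → ℝ}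
    (hF : G.PhaseIntegrable (fun p I => G.p0 p * G.w I * F p I)) (μ : Fin 4) :
    G.InvIntegrable (fun p I => G.fourMom p μ * F p I) := by
  refine PhaseIntegrable.congr (PhaseIntegrable.bdd_mul hF
    -- One `p⁰` comes from `dp/p⁰`; the bound is `p⁰ w ≥ mc`.
    (K := fun p I => G.fourMom p μ / (G.p0 p * (G.p0 p * G.w I)))
    (by fun_prop) (1 / (G.m * G.c)) fun p I hI => ?_) fun p I hI => ?_
  · have h0 := hG.mc_pos
    have hp := hG.p0_pos p
    have hw := hG.one_le_w hI
    rw [abs_div, abs_of_pos (by positivity : 0 < G.p0 p * _), div_le_div_iff₀ (by positivity) h0,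
      one_mul]
    have h1 : G.m * G.c ≤ G.p0 p * G.w I := by nlinarith [hG.mc_le_p0 p]
    exact mul_le_mul (G.abs_fourMom_le p μ) h1 h0.le hp.le
  · have hp := hG.p0_pos p
    have hw := hG.w_pos hI
    field_simp

lemma invIntegrable_fourMom_two_mul (hG : G.Admissible) {F : R3 → ℝ → ℝ}
    (hF : G.PhaseIntegrable (fun p I => G.p0 p * G.w I * F p I)) (μ ν : Fin 4) :
    G.InvIntegrable (fun p I => G.fourMom p μ * (G.fourMom p ν * (F p I * G.w I))) := by
  refine PhaseIntegrable.congr (PhaseIntegrable.bdd_mul hF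
    (K := fun p _ => G.fourMom p μ * G.fourMom p ν / (G.p0 p * G.p0 p))
    (by fun_prop) 1 fun p I _ => ?_) fun p I _ => ?_
  · have hp := hG.p0_pos p
    rw [abs_div, abs_of_pos (by positivity : 0 < G.p0 p * _), div_le_one (by positivity), abs_mul]
    exact mul_le_mul (G.abs_fourMom_le p μ) (G.abs_fourMom_le p ν) (abs_nonneg _) hp.le
  · have hp := hG.p0_pos p
    field_simp

variable (G) in
lemma velocity_eq (F : R3 → ℝ → ℝ) : G.velocity F =
    (G.c / G.numDensity F) • fun μ => G.invInt (fun p I => G.fourMom p μ * F p I) := rfl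

lemma mink_flux (hG : G.Admissible) {F : R3 → ℝ → ℝ} (hn : 0 < G.numDensity F) :
    mink (fun μ => G.invInt (fun p I => G.fourMom p μ * F p I))
      (fun μ => G.invInt (fun p I => G.fourMom p μ * F p I)) = G.numDensity F ^ 2 := by
  rw [numDensity, Real.sqrt_pos] at hn
  rw [numDensity, Real.sq_sqrt hn.le]
  simp only [mink, fourMom_zero, fourMom_succ, invInt_p0_mul hG, ← pow_two]

lemma HasEckartFrame.exists_velocity_eq (hG : G.Admissible) {F : R3 → ℝ → ℝ}
    (hF : G.HasEckartFrame F) : ∃ u : R3, G.velocity F = G.c • lorentz u timeAxis := by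
  have hn := hF.n_pos
  have hc := hG.c_pos
  obtain ⟨u, hu⟩ := exists_lorentz_timeAxis (V := (1 / G.numDensity F) •
      fun μ => G.invInt (fun p I => G.fourMom p μ * F p I))
    (by
      rw [mink_smul_left, mink_smul_right, mink_flux hG hn]
      field_simp)
    (by
      have := hF.total_pos
      simp only [Pi.smul_apply, fourMom_zero, invInt_p0_mul hG, smul_eq_mul]
      positivity)
  refine ⟨u, ?_⟩
  rw [hu, velocity_eq, smul_smul, mul_one_div]

lemma mink_velocity_flux (hG : G.Admissible) {F : R3 → ℝ → ℝ} (hF : G.HasEckartFrame F) :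
    G.invInt (fun p I => mink (G.velocity F) (G.fourMom p) * F p I) =
      G.c * G.numDensity F := by
  have hn := hF.n_pos
  have h := invInt_linear (invIntegrable_fourMom_mul hG hF.moments) (minkLin (G.velocity F))
  simp only [minkLin_apply] at h
  rw [h, velocity_eq, mink_smul_left, mink_flux hG hn]
  field_simp

variable (G) in
/-- The momentum flux `∫∫ p^μ (U^ν p_ν) F (1 + I/(mc²)) φ dI dp/p⁰` in the Eckart frame. -/
def frameFlux (F : R3 → ℝ → ℝ) (μ : Fin 4) : ℝ :=
  G.invInt (fun p I => mink (G.velocity F) (G.fourMom p) * (G.fourMom p μ * (F p I * G.w I)))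

lemma energy_eq (hG : G.Admissible) {F : R3 → ℝ → ℝ} (hF : G.HasEckartFrame F) :
    G.energy F = 1 / G.c * mink (G.velocity F) (G.frameFlux F) := by
  have hint : ∀ μ, G.InvIntegrable (fun p I => G.fourMom p μ *
      (mink (G.velocity F) (G.fourMom p) * (F p I * G.w I))) := fun μ =>
    (InvIntegrable.linear (fun κ => invIntegrable_fourMom_two_mul hG hF.moments κ μ)
      (minkLin (G.velocity F))).congr fun p I _ => by simp only [minkLin_apply]; ring
  have h := invInt_linear hint (minkLin (G.velocity F))
  simp only [minkLin_apply] at h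
  rw [energy]
  congr 1
  refine Eq.trans (G.invInt_congr fun p I _ => ?_) (h.trans ?_)
  · ring
  · congr 1
    ext μ
    exact G.invInt_congr fun p I _ => by ring

/-- The splitting `c S = e U + q`, the only way in which the heat flux enters the argument about
moments. -/
lemma heatFlux_eq (hG : G.Admissible) (F : R3 → ℝ → ℝ) :
    G.heatFlux F = G.c • G.frameFlux F - G.energy F • G.velocity F := by
  have := hG.c_pos
  ext μ
  rw [heatFlux, energy]
  have h : G.frameFlux F μ = G.invInt (fun p I =>
      G.fourMom p μ * mink (G.velocity F) (G.fourMom p) * F p I * G.w I) :=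
    G.invInt_congr fun p I _ => by ring
  simp only [Pi.sub_apply, Pi.smul_apply, smul_eq_mul, h]
  ring

lemma mink_velocity_velocity (hG : G.Admissible) {F : R3 → ℝ → ℝ} (hF : G.HasEckartFrame F) :
    mink (G.velocity F) (G.velocity F) = G.c ^ 2 := by
  obtain ⟨u, hu⟩ := hF.exists_velocity_eq hG
  rw [hu, mink_smul_left, mink_smul_right, mink_lorentz, mink_timeAxis]
  simp [timeAxis, pow_two]

/-- Contracting `q = c S - e U` with `U` gives `c · c e - e c² = 0`. -/
lemma mink_velocity_heatFlux (hG : G.Admissible) {F : R3 → ℝ → ℝ} (hF : G.HasEckartFrame F) :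
    mink (G.velocity F) (G.heatFlux F) = 0 := by
  have := hG.c_pos
  rw [heatFlux_eq hG, sub_eq_add_neg, ← neg_smul, mink_add_right, mink_smul_right, mink_smul_right,
    mink_velocity_velocity hG hF, energy_eq hG hF]
  field_simp
  ring

/-! ### Moments of the modified equilibrium -/

/-- In the rest frame `U·p = c p⁰`, and the factor `(mc)³` in the normalisation undoes the rescaling
of momentum in `Z`. -/
lemma equilibrium_boost (hG : G.Admissible) {F : R3 → ℝ → ℝ} (hF : G.HasEckartFrame F) {T : ℝ}
    (hT : 0 < T) {u : R3} (hu : G.velocity F = G.c • lorentz u timeAxis) (p : R3) (I : ℝ) :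
    G.equilibrium F T (G.boost u p) I =
      G.numDensity F / G.phaseInt (G.boltzmann (G.invTemp T)) * G.boltzmann (G.invTemp T) p I := by
  have hM := hG.mc_pos
  have hZ : 0 < G.partitionFn T := by
    have := phaseInt_pos hG hF.total_pos.ne' (phaseIntegrable_boltzmann hG (invTemp_pos hG hT))
      fun p I _ _ => boltzmann_pos _ p I
    rw [partitionFn_eq hG]
    positivity
  have h := G.exp_chemPot F T hG.m_pos hG.c_pos hG.kB_pos hT hF.n_pos hZ
  rw [partitionFn_eq hG, mul_inv_cancel_left₀ (by positivity)] at h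
  rw [equilibrium, sub_eq_add_neg, Real.exp_add, h, hu, fourMom_boost, mink_smul_left, mink_lorentz,
    mink_timeAxis, fourMom_zero, boltzmann, invTemp]
  congr 2
  ring

lemma modEquilibrium_boost (hG : G.Admissible) {F : R3 → ℝ → ℝ} (hF : G.HasEckartFrame F) {T : ℝ}
    (hT : 0 < T) {u : R3} (hu : G.velocity F = G.c • lorentz u timeAxis) (p : R3) (I : ℝ) :
    G.modEquilibrium F T (G.boost u p) I =
      G.restMod (G.numDensity F / G.phaseInt (G.boltzmann (G.invTemp T)))
        (1 / (G.b F T * G.m * G.c ^ 2)) (G.invTemp T) (lorentz (-u) (G.heatFlux F)) p I := by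
  rw [modEquilibrium, equilibrium_boost hG hF hT hu, restMod, fourMom_boost]
  nth_rw 1 [← lorentz_lorentz_neg u (G.heatFlux F)]
  rw [mink_lorentz, mink_comm, mul_one_div]

lemma rest_heatFlux_zero (hG : G.Admissible) {F : R3 → ℝ → ℝ} (hF : G.HasEckartFrame F)
    {u : R3} (hu : G.velocity F = G.c • lorentz u timeAxis) :
    lorentz (-u) (G.heatFlux F) 0 = 0 := by
  have h := mink_velocity_heatFlux hG hF
  rw [hu, mink_smul_left, ← lorentz_lorentz_neg u (G.heatFlux F), mink_lorentz, mink_timeAxis] at h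
  exact (mul_eq_zero.1 h).resolve_left hG.c_pos.ne'

lemma invIntegrable_fourMom_modEquilibrium (hG : G.Admissible) {F : R3 → ℝ → ℝ}
    (hF : G.HasEckartFrame F) {T : ℝ} (hT : 0 < T) (μ : Fin 4) :
    G.InvIntegrable (fun p I => G.fourMom p μ * G.modEquilibrium F T p I) := by
  obtain ⟨u, hu⟩ := hF.exists_velocity_eq hG
  rw [← invIntegrable_boost_iff hG u]
  simp only [modEquilibrium_boost hG hF hT hu, fourMom_boost]
  exact InvIntegrable.linear
    (fun κ => invIntegrable_fourMom_restMod hG (invTemp_pos hG hT) _ _ _ κ)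
    (LinearMap.proj μ ∘ₗ lorentz u)

lemma invIntegrable_fourMom_two_modEquilibrium (hG : G.Admissible) {F : R3 → ℝ → ℝ}
    (hF : G.HasEckartFrame F) {T : ℝ} (hT : 0 < T) (μ ν : Fin 4) :
    G.InvIntegrable (fun p I =>
      G.fourMom p μ * (G.fourMom p ν * (G.modEquilibrium F T p I * G.w I))) := by
  obtain ⟨u, hu⟩ := hF.exists_velocity_eq hG
  rw [← invIntegrable_boost_iff hG u]
  simp only [modEquilibrium_boost hG hF hT hu, fourMom_boost]
  -- The boosted moment is bilinear in the momentum, so the two indices are expanded one after the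
  -- other.
  refine InvIntegrable.linear (fun κ => ?_) (LinearMap.proj μ ∘ₗ lorentz u)
  refine (InvIntegrable.linear
    (fun κ' => invIntegrable_fourMom_two_restMod hG (invTemp_pos hG hT)
      (G.numDensity F / G.phaseInt (G.boltzmann (G.invTemp T))) (1 / (G.b F T * G.m * G.c ^ 2))
      (lorentz (-u) (G.heatFlux F)) κ' κ)
    (LinearMap.proj ν ∘ₗ lorentz u)).congr fun p I _ => ?_
  simp only [LinearMap.comp_apply, LinearMap.proj_apply]
  ring

lemma invInt_velocity_modEquilibrium (hG : G.Admissible) {F : R3 → ℝ → ℝ}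
    (hF : G.HasEckartFrame F) {T : ℝ} (hT : 0 < T) :
    G.invInt (fun p I => mink (G.velocity F) (G.fourMom p) * G.modEquilibrium F T p I) =
      G.c * G.numDensity F := by
  obtain ⟨u, hu⟩ := hF.exists_velocity_eq hG
  have hE := phaseInt_pos hG hF.total_pos.ne' (phaseIntegrable_boltzmann hG (invTemp_pos hG hT))
    fun p I _ _ => boltzmann_pos _ p I
  rw [← invInt_boost hG u]
  simp only [modEquilibrium_boost hG hF hT hu, fourMom_boost]
  simp only [hu, mink_smul_left, mink_lorentz, mink_timeAxis, fourMom_zero, mul_assoc,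
    invInt_const_mul]
  rw [invInt_p0_restMod hG (invTemp_pos hG hT) _ _ (rest_heatFlux_zero hG hF hu),
    div_mul_cancel₀ _ hE.ne']

/-- The heart of the matter. The rest-frame moment is `(e/c)` times the time axis plus `q/c²`, with
`q` seen in the rest frame; applying the boost and multiplying by `c` gives `(e U + q)/c = S`. -/
lemma invInt_velocity_fourMom_modEquilibrium (hG : G.Admissible) {F : R3 → ℝ → ℝ}
    (hF : G.HasEckartFrame F) {T : ℝ} (hT : G.IsTemperature F T) (ν : Fin 4) :
    G.invInt (fun p I => mink (G.velocity F) (G.fourMom p) *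
      (G.fourMom p ν * (G.modEquilibrium F T p I * G.w I))) = G.frameFlux F ν := by
  obtain ⟨u, hu⟩ := hF.exists_velocity_eq hG
  obtain ⟨hT, heq⟩ := hT
  have hm := hG.m_pos
  have hc := hG.c_pos
  have hn := hF.n_pos
  have hβ := invTemp_pos hG hT
  have hE := phaseInt_pos hG hF.total_pos.ne' (phaseIntegrable_boltzmann hG hβ)
    fun p I _ _ => boltzmann_pos _ p I
  have hE2 := phaseInt_pos hG hF.total_pos.ne' (phaseIntegrable_norm_sq_boltzmann hG hβ)
    fun p I hp hI => by
      have := boltzmann_pos (G := G) (G.invTemp T) p I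
      have := hG.w_pos hI
      have := norm_pos_iff.2 hp
      positivity
  have hb := b_eq hG F hT
  have hS : G.frameFlux F =
      (1 / G.c) • (G.energy F • G.velocity F + G.heatFlux F) := by
    rw [heatFlux_eq hG, add_sub_cancel, smul_smul, one_div_mul_cancel hc.ne', one_smul]
  rw [eTilde_eq hG, div_eq_div_iff hE.ne' hn.ne'] at heq
  have hR := invInt_p0_fourMom_restMod hG hβ
    (G.numDensity F / G.phaseInt (G.boltzmann (G.invTemp T)))
    (1 / (G.b F T * G.m * G.c ^ 2)) (rest_heatFlux_zero hG hF hu)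
  set E0 := G.phaseInt (G.boltzmann (G.invTemp T))
  set E1 := G.phaseInt (fun p I => G.p0 p * (G.w I * G.boltzmann (G.invTemp T) p I))
  set E2 := G.phaseInt (fun p I => ‖p‖ ^ 2 * (G.w I ^ 2 * G.boltzmann (G.invTemp T) p I))
  -- The temperature equation `ẽ(T) = e/n`.
  have hc1 : G.numDensity F / E0 * E1 = G.energy F / G.c := by
    field_simp
    linarith
  -- The definition of `b` enters here and nowhere else in this computation.
  have hc2 : G.numDensity F / E0 * (1 / (G.b F T * G.m * G.c ^ 2)) * (1 / 3 * E2) =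
      1 / G.c ^ 2 := by
    rw [hb]
    field_simp
  rw [hc1, hc2] at hR
  rw [← invInt_boost hG u]
  simp only [modEquilibrium_boost hG hF hT hu, fourMom_boost]
  have hlin := invInt_linear (H := fun p I => G.p0 p *
      (G.restMod (G.numDensity F / E0) (1 / (G.b F T * G.m * G.c ^ 2)) (G.invTemp T)
        (lorentz (-u) (G.heatFlux F)) p I * G.w I))
    (fun κ => (invIntegrable_fourMom_two_restMod hG hβ _ _ _ 0 κ).congr fun p I _ => by
      simp only [fourMom_zero]; ring)
    (LinearMap.proj ν ∘ₗ lorentz u)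
  rw [hR, LinearMap.comp_apply, map_add, map_smul, map_smul, lorentz_lorentz_neg] at hlin
  rw [hS]
  refine Eq.trans (G.invInt_congr fun p I _ => ?_)
    ((invInt_const_mul _ G.c).trans ((congrArg (G.c * ·) hlin).trans ?_))
  · simp only [hu, mink_smul_left, mink_lorentz, mink_timeAxis, fourMom_zero,
      LinearMap.comp_apply, LinearMap.proj_apply]
    ring
  · simp only [hu, LinearMap.proj_apply, Pi.add_apply, Pi.smul_apply, smul_eq_mul]
    field_simp

/-! ### The conservation identities -/

variable {F : R3 → ℝ → ℝ} {T : ℝ}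

lemma invIntegrable_fourMom_defect (hG : G.Admissible) (hF : G.HasEckartFrame F) (hT : 0 < T)
    (μ : Fin 4) :
    G.InvIntegrable (fun p I => G.fourMom p μ * (G.modEquilibrium F T p I - F p I)) :=
  ((invIntegrable_fourMom_modEquilibrium hG hF hT μ).sub
    (invIntegrable_fourMom_mul hG hF.moments μ)).congr fun p I _ => by ring

lemma invIntegrable_fourMom_two_defect (hG : G.Admissible) (hF : G.HasEckartFrame F) (hT : 0 < T)
    (μ ν : Fin 4) :
    G.InvIntegrable (fun p I =>
      G.fourMom p μ * (G.fourMom p ν * (G.modEquilibrium F T p I - F p I) * G.w I)) :=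
  ((invIntegrable_fourMom_two_modEquilibrium hG hF hT μ ν).sub
    (invIntegrable_fourMom_two_mul hG hF.moments μ ν)).congr fun p I _ => by ring

lemma invInt_velocity_defect (hG : G.Admissible) (hF : G.HasEckartFrame F) (hT : 0 < T) :
    G.invInt (fun p I => mink (G.velocity F) (G.fourMom p) *
      (G.modEquilibrium F T p I - F p I)) = 0 := by
  have h := invInt_sub
    (InvIntegrable.linear (invIntegrable_fourMom_modEquilibrium hG hF hT) (minkLin (G.velocity F)))
    (InvIntegrable.linear (invIntegrable_fourMom_mul hG hF.moments) (minkLin (G.velocity F)))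
  simp only [minkLin_apply] at h
  rw [invInt_velocity_modEquilibrium hG hF hT, mink_velocity_flux hG hF, sub_self] at h
  simpa only [mul_sub] using h

lemma invInt_velocity_fourMom_defect (hG : G.Admissible) (hF : G.HasEckartFrame F)
    (hT : G.IsTemperature F T) (ν : Fin 4) :
    G.invInt (fun p I => mink (G.velocity F) (G.fourMom p) *
      (G.fourMom p ν * (G.modEquilibrium F T p I - F p I) * G.w I)) = 0 := by
  have h := invInt_sub
    (InvIntegrable.linear (fun μ => invIntegrable_fourMom_two_modEquilibrium hG hF hT.1 μ ν)
      (minkLin (G.velocity F)))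
    (InvIntegrable.linear (fun μ => invIntegrable_fourMom_two_mul hG hF.moments μ ν)
      (minkLin (G.velocity F)))
  simp only [minkLin_apply] at h
  rw [invInt_velocity_fourMom_modEquilibrium hG hF hT, ← frameFlux, sub_self] at h
  rw [← h]
  exact G.invInt_congr fun p I _ => by ring

lemma mink_velocity_defect (hG : G.Admissible) (hF : G.HasEckartFrame F) (hT : 0 < T) :
    mink (G.velocity F) (fun μ => G.invInt (fun p I =>
      G.fourMom p μ * (G.modEquilibrium F T p I - F p I))) = 0 :=
  (invInt_linear (invIntegrable_fourMom_defect hG hF hT) (minkLin (G.velocity F))).symm.trans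
    (invInt_velocity_defect hG hF hT)

lemma mink_velocity_fourMom_defect (hG : G.Admissible) (hF : G.HasEckartFrame F)
    (hT : G.IsTemperature F T) (ν : Fin 4) :
    mink (G.velocity F) (fun μ => G.invInt (fun p I =>
      G.fourMom p μ * G.fourMom p ν * (G.modEquilibrium F T p I - F p I) * G.w I)) = 0 := by
  refine Eq.trans ?_ ((invInt_linear
    (fun μ => invIntegrable_fourMom_two_defect hG hF hT.1 μ ν)
    (minkLin (G.velocity F))).symm.trans (invInt_velocity_fourMom_defect hG hF hT ν))
  simp only [minkLin_apply, mul_assoc]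

end Gas

/-! ### Measurability of derivatives with respect to a parameter -/

lemma aestronglyMeasurable_of_apply {α E : Type*} [MeasurableSpace α] {μ : Measure α}
    [NormedAddCommGroup E] [NormedSpace ℝ E] [FiniteDimensional ℝ E] {L : α → E →L[ℝ] ℝ}
    (hL : ∀ v, AEStronglyMeasurable (fun a => L a v) μ) : AEStronglyMeasurable L μ := by
  let b := Module.finBasis ℝ E
  have h : L = fun a => ∑ i, L a (b i) • LinearMap.toContinuousLinearMap (b.coord i) := by
    ext a v
    have hv := congrArg (L a) (b.sum_repr v)
    rw [map_sum] at hv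
    rw [← hv]
    simp [mul_comm]
  rw [h]
  refine Finset.aestronglyMeasurable_fun_sum _ fun i _ => ?_
  exact (hL (b i)).smul_const _

/-- Measurability of the derivative in `(p, I)` is not assumed; it follows because directional
derivatives are limits of the difference quotients along `x + v/n`. -/
lemma aestronglyMeasurable_fderiv_param {α E : Type*} [MeasurableSpace α] {μ : Measure α}
    [NormedAddCommGroup E] [NormedSpace ℝ E] [FiniteDimensional ℝ E] {f : E → α → ℝ} {x : E}
    {s : Set E} (hs : s ∈ 𝓝 x) (hf : ∀ y ∈ s, AEStronglyMeasurable (f y) μ)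
    {f' : α → E →L[ℝ] ℝ} (hd : ∀ᵐ a ∂μ, HasFDerivAt (fun y => f y a) (f' a) x) :
    AEStronglyMeasurable f' μ := by
  refine aestronglyMeasurable_of_apply fun v => ?_
  have hc : Filter.Tendsto (fun n : ℕ => ‖(n : ℝ)‖) Filter.atTop Filter.atTop := by
    simpa using tendsto_natCast_atTop_atTop (R := ℝ)
  have ht : Filter.Tendsto (fun n : ℕ => x + (n : ℝ)⁻¹ • v) Filter.atTop (𝓝 x) := by
    simpa using (tendsto_inv_atTop_nhds_zero_nat (𝕜 := ℝ)).smul_const v |>.const_add x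
  -- Shifting the index by `N` keeps every sample point inside `s`, where `f` is known to be
  -- measurable.
  obtain ⟨N, hN⟩ := Filter.eventually_atTop.1 (ht.eventually_mem hs)
  refine aestronglyMeasurable_of_tendsto_ae Filter.atTop
    (f := fun (n : ℕ) a => ((n + N : ℕ) : ℝ) • (f (x + ((n + N : ℕ) : ℝ)⁻¹ • v) a - f x a))
    (fun n => ?_) ?_
  · have hsub := (hf _ (hN _ (Nat.le_add_left N n))).sub (hf x (mem_of_mem_nhds hs))
    exact hsub.const_smul ((n + N : ℕ) : ℝ)
  · filter_upwards [hd] with a ha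
    exact (ha.lim v hc).comp (Filter.tendsto_add_atTop_nat N)

namespace Gas

variable {G : Gas} {τ : ℝ} {Ω : Set Spacetime} {F : Spacetime → R3 → ℝ → ℝ} {T : Spacetime → ℝ}

/-! ### Differentiation of moments -/

lemma PhaseIntegrable.of_weight (hG : G.Admissible) {H K : R3 → ℝ → ℝ}
    (hH : G.PhaseIntegrable (fun p I => G.p0 p * G.w I * H p I))
    (hK : Measurable fun z : R3 × ℝ => K z.1 z.2) {C : ℝ}
    (hC : ∀ p I, 0 < I → |K p I| ≤ C * (G.p0 p * G.w I)) :
    G.PhaseIntegrable (fun p I => K p I * H p I) := by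
  refine PhaseIntegrable.congr (PhaseIntegrable.bdd_mul hH
    (K := fun p I => K p I / (G.p0 p * G.w I)) (by fun_prop) C fun p I hI => ?_) fun p I hI => ?_
  · have hp := hG.p0_pos p
    have hw := hG.w_pos hI
    rw [abs_div, abs_of_pos (mul_pos hp hw), div_le_iff₀ (mul_pos hp hw)]
    exact hC p I hI
  · have hp := hG.p0_pos p
    have hw := hG.w_pos hI
    field_simp

lemma IsClassicalSolution.hasFDerivAt_phaseInt (hG : G.Admissible)
    (h : G.IsClassicalSolution τ Ω F T) (hΩ : IsOpen Ω) {X : Spacetime} (hX : X ∈ Ω)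
    {K : R3 → ℝ → ℝ} (hK : Measurable fun z : R3 × ℝ => K z.1 z.2) {C : ℝ}
    (hC : ∀ p I, 0 < I → |K p I| ≤ C * (G.p0 p * G.w I)) :
    Integrable (fun z : R3 × ℝ =>
      (K z.1 z.2 * G.φ z.2) • fderiv ℝ (fun Y => F Y z.1 z.2) X) vol ∧
    HasFDerivAt (fun Y => G.phaseInt (fun p I => K p I * F Y p I))
      (∫ z : R3 × ℝ, (K z.1 z.2 * G.φ z.2) • fderiv ℝ (fun Y => F Y z.1 z.2) X ∂vol) X := by
  obtain ⟨g, hg, hbound⟩ := h.dominated X hX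
  have hint : ∀ Y ∈ Ω, G.PhaseIntegrable (fun p I => K p I * F Y p I) := fun Y hY =>
    PhaseIntegrable.of_weight hG (h.frame Y hY).moments hK hC
  have hnhds : {Y | Y ∈ Ω ∧ ∀ p : R3, ∀ I : ℝ, 0 < I →
      ‖fderiv ℝ (fun Z => F Z p I) Y‖ ≤ g p I} ∈ 𝓝 X := Filter.inter_mem (hΩ.mem_nhds hX) hbound
  have hderiv : ∀ᵐ z : R3 × ℝ ∂vol, ∀ Y ∈ Ω,
      HasFDerivAt (fun Y => K z.1 z.2 * F Y z.1 z.2 * G.φ z.2)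
        ((K z.1 z.2 * G.φ z.2) • fderiv ℝ (fun Z => F Z z.1 z.2) Y) Y := by
    filter_upwards [ae_vol_pos] with z hz Y hY
    have := (((h.differentiable z.1 z.2 hz).differentiableAt (hΩ.mem_nhds hY)).hasFDerivAt).const_mul
      (K z.1 z.2 * G.φ z.2)
    exact this.congr_of_eventuallyEq (.of_forall fun Y => by simp only []; ring)
  have hmeas := aestronglyMeasurable_fderiv_param (hΩ.mem_nhds hX)
    (fun Y hY => (hint Y hY).aestronglyMeasurable) (hderiv.mono fun z hz => hz X hX)
  have hle : ∀ᵐ z : R3 × ℝ ∂vol, ∀ Y ∈ {Y | Y ∈ Ω ∧ ∀ p : R3, ∀ I : ℝ, 0 < I →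
      ‖fderiv ℝ (fun Z => F Z p I) Y‖ ≤ g p I},
      ‖(K z.1 z.2 * G.φ z.2) • fderiv ℝ (fun Z => F Z z.1 z.2) Y‖ ≤
        C * (G.p0 z.1 * G.w z.2 * g z.1 z.2 * G.φ z.2) := by
    filter_upwards [ae_vol_pos] with z hz Y hY
    have hφ := hG.φ_nonneg z.2 hz
    rw [norm_smul, Real.norm_eq_abs, abs_mul, abs_of_nonneg hφ]
    have h1 := hC z.1 z.2 hz
    have h2 := hY.2 z.1 z.2 hz
    calc _ ≤ C * (G.p0 z.1 * G.w z.2) * G.φ z.2 * g z.1 z.2 :=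
          mul_le_mul (mul_le_mul_of_nonneg_right h1 hφ) h2 (norm_nonneg _)
            (mul_nonneg ((abs_nonneg _).trans h1) hφ)
      _ = _ := by ring
  have hb := Integrable.const_mul hg C
  refine ⟨Integrable.mono' hb hmeas (hle.mono fun z hz => hz X (mem_of_mem_nhds hnhds)), ?_⟩
  exact hasFDerivAt_integral_of_dominated_of_fderiv_le hnhds
    ((hΩ.eventually_mem hX).mono fun Y hY => (hint Y hY).aestronglyMeasurable) (hint X hX) hmeas
    hle hb (hderiv.mono fun z hz Y hY => hz Y hY.1)

/-! ### Balance laws for weighted moments -/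

section Weighted

variable {W : R3 → ℝ → ℝ} {C : ℝ}

lemma abs_fourMom_mul_div_le (hG : G.Admissible)
    (hC : ∀ p I, 0 < I → |W p I| ≤ C * (G.p0 p * G.w I)) (μ : Fin 4) (p : R3) (I : ℝ)
    (hI : 0 < I) : |G.fourMom p μ * W p I / G.p0 p| ≤ C * (G.p0 p * G.w I) := by
  have hp := hG.p0_pos p
  rw [abs_div, abs_mul, abs_of_pos hp, div_le_iff₀ hp, mul_comm]
  exact mul_le_mul (hC p I hI) (G.abs_fourMom_le p μ) (abs_nonneg _)
    ((abs_nonneg _).trans (hC p I hI))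

lemma IsClassicalSolution.hasFDerivAt_invInt (hG : G.Admissible)
    (h : G.IsClassicalSolution τ Ω F T) (hΩ : IsOpen Ω) {X : Spacetime} (hX : X ∈ Ω)
    (hW : Measurable fun z : R3 × ℝ => W z.1 z.2)
    (hC : ∀ p I, 0 < I → |W p I| ≤ C * (G.p0 p * G.w I)) (μ : Fin 4) :
    HasFDerivAt (fun Y => G.invInt (fun p I => G.fourMom p μ * (F Y p I * W p I)))
      (∫ z : R3 × ℝ, (G.fourMom z.1 μ * W z.1 z.2 / G.p0 z.1 * G.φ z.2) •
        fderiv ℝ (fun Y => F Y z.1 z.2) X ∂vol) X := by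
  have h1 := (h.hasFDerivAt_phaseInt hG hΩ hX (K := fun p I => G.fourMom p μ * W p I / G.p0 p)
    (by fun_prop) (abs_fourMom_mul_div_le hG hC μ)).2
  refine h1.congr_of_eventuallyEq (.of_forall fun Y => ?_)
  exact G.phaseInt_congr fun p I _ => by ring

/-- The transport operator `p^μ ∂_μ` divided by `p⁰`. -/
lemma sum_fourMom_coordDir (hG : G.Admissible) (D : Spacetime →L[ℝ] ℝ) (p : R3) :
    ∑ μ, G.fourMom p μ / G.p0 p * D (G.coordDir μ) =
      1 / G.c * (D (1, 0) + D (0, (G.c / G.p0 p) • p)) := by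
  have hc := hG.c_pos
  have hp := hG.p0_pos p
  have h0 : ((1 / G.c, 0) : Spacetime) = (1 / G.c) • (1, 0) := by ext <;> simp
  have h1 : ((0, (G.c / G.p0 p) • p) : Spacetime) =
      ∑ i : Fin 3, (G.c / G.p0 p * p i) • ((0, EuclideanSpace.single i 1) : Spacetime) := by
    refine Prod.ext (by simp [Prod.fst_sum]) ?_
    ext j
    simp [Fin.sum_univ_three]
    fin_cases j <;> simp
  rw [h1, map_sum, Fin.sum_univ_succ]
  simp only [coordDir, Fin.cons_zero, Fin.cons_succ, h0, map_smul, smul_eq_mul, fourMom_zero,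
    fourMom_succ, mul_add, Finset.mul_sum]
  rw [div_self hp.ne', one_mul]
  congr 1
  refine Finset.sum_congr rfl fun i _ => ?_
  field_simp

/-- Under the integral the sum is the transport operator, which the equation replaces by the
collision term. One factor `1/c` comes from `x⁰ = c t`, the other from `1/(c τ p⁰)`. -/
lemma IsClassicalSolution.sum_fderiv_invInt (hG : G.Admissible)
    (h : G.IsClassicalSolution τ Ω F T) (hΩ : IsOpen Ω) {X : Spacetime} (hX : X ∈ Ω)
    (hW : Measurable fun z : R3 × ℝ => W z.1 z.2)
    (hC : ∀ p I, 0 < I → |W p I| ≤ C * (G.p0 p * G.w I)) :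
    ∑ μ, fderiv ℝ (fun Y => G.invInt (fun p I => G.fourMom p μ * (F Y p I * W p I))) X
      (G.coordDir μ) =
    1 / (G.c ^ 2 * τ) * G.invInt (fun p I => mink (G.velocity (F X)) (G.fourMom p) *
      (W p I * (G.modEquilibrium (F X) (T X) p I - F X p I))) := by
  have hint := fun μ : Fin 4 => (h.hasFDerivAt_phaseInt hG hΩ hX
    (K := fun p I => G.fourMom p μ * W p I / G.p0 p) (by fun_prop)
    (abs_fourMom_mul_div_le hG hC μ)).1
  simp only [(h.hasFDerivAt_invInt hG hΩ hX hW hC _).fderiv]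
  simp only [ContinuousLinearMap.integral_apply (hint _)]
  rw [← integral_finsetSum _ fun μ _ => (hint μ).apply_continuousLinearMap _, ← invInt_const_mul]
  refine integral_congr_ae ?_
  filter_upwards [ae_vol_pos] with z hz
  have heq := h.equation X hX z.1 z.2 hz
  have hs := sum_fourMom_coordDir hG (fderiv ℝ (fun Y => F Y z.1 z.2) X) z.1
  rw [heq] at hs
  have hp := hG.p0_pos z.1
  calc _ = W z.1 z.2 * G.φ z.2 * ∑ μ, G.fourMom z.1 μ / G.p0 z.1 *
        fderiv ℝ (fun Y => F Y z.1 z.2) X (G.coordDir μ) := by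
        rw [Finset.mul_sum]
        refine Finset.sum_congr rfl fun μ _ => ?_
        rw [smul_apply, smul_eq_mul]
        ring
    _ = _ := by
        rw [hs]
        ring

/-- Common form of both laws: `W = 1` gives the particle flux, `W = p^ν (mc² + I)` the
energy-momentum tensor. -/
lemma IsClassicalSolution.conservation (hG : G.Admissible)
    (h : G.IsClassicalSolution τ Ω F T) (hΩ : IsOpen Ω) {X : Spacetime} (hX : X ∈ Ω)
    (hW : Measurable fun z : R3 × ℝ => W z.1 z.2)
    (hC : ∀ p I, 0 < I → |W p I| ≤ C * (G.p0 p * G.w I)) {A : Spacetime → Fin 4 → ℝ} {k : ℝ}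
    (hA : ∀ Y μ, A Y μ = k * G.invInt (fun p I => G.fourMom p μ * (F Y p I * W p I)))
    (hzero : G.invInt (fun p I => mink (G.velocity (F X)) (G.fourMom p) *
      (W p I * (G.modEquilibrium (F X) (T X) p I - F X p I))) = 0) :
    (∀ μ, DifferentiableAt ℝ (fun Y => A Y μ) X) ∧ G.divergence A X = 0 := by
  have hd := fun μ => (h.hasFDerivAt_invInt hG hΩ hX hW hC μ).differentiableAt
  simp only [divergence, hA]
  refine ⟨fun μ => (hd μ).const_mul k, ?_⟩
  simp only [fun μ => fderiv_const_mul (hd μ) k, smul_apply, smul_eq_mul, ← Finset.mul_sum]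
  rw [h.sum_fderiv_invInt hG hΩ hX hW hC, hzero, mul_zero, mul_zero]

end Weighted

lemma IsClassicalSolution.particleFlux_conservation (hG : G.Admissible)
    (h : G.IsClassicalSolution τ Ω F T) (hΩ : IsOpen Ω) {X : Spacetime} (hX : X ∈ Ω) :
    (∀ μ, DifferentiableAt ℝ (fun Y => G.particleFlux (F Y) μ) X) ∧
      G.divergence (fun Y => G.particleFlux (F Y)) X = 0 := by
  -- The constant comes from `mc ≤ p⁰ ≤ p⁰ w`.
  refine h.conservation hG hΩ hX (W := fun _ _ => 1) (C := 1 / (G.m * G.c)) measurable_const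
    (fun p I hI => ?_) (A := fun Y => G.particleFlux (F Y)) (k := G.m * G.c) (fun Y μ => ?_) ?_
  · have h0 := hG.mc_pos
    have h1 := hG.mc_le_p0 p
    have h2 := hG.one_le_w hI
    rw [abs_one, one_div, ← div_eq_inv_mul, le_div_iff₀ h0, one_mul]
    nlinarith
  · simp only [particleFlux, mul_one]
  · simp only [one_mul]
    exact invInt_velocity_defect hG (h.frame X hX) (h.temperature X hX).1

lemma IsClassicalSolution.energyMomentum_conservation (hG : G.Admissible)
    (h : G.IsClassicalSolution τ Ω F T) (hΩ : IsOpen Ω) {X : Spacetime} (hX : X ∈ Ω)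
    (ν : Fin 4) :
    (∀ μ, DifferentiableAt ℝ (fun Y => G.energyMomentum (F Y) μ ν) X) ∧
      G.divergence (fun Y μ => G.energyMomentum (F Y) μ ν) X = 0 := by
  have hm := hG.m_pos
  have hc := hG.c_pos
  have hw : ∀ I, G.m * G.c ^ 2 + I = G.m * G.c ^ 2 * G.w I := fun I => by
    rw [w]
    field_simp
  -- The constant comes from `|p^ν| ≤ p⁰` and `mc² + I = mc² w`.
  refine h.conservation hG hΩ hX (W := fun p I => G.fourMom p ν * (G.m * G.c ^ 2 + I))
    (C := G.m * G.c ^ 2) (by fun_prop) (fun p I hI => ?_)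
    (A := fun Y μ => G.energyMomentum (F Y) μ ν) (k := 1 / (G.m * G.c)) (fun Y μ => ?_) ?_
  · have hwp := hG.w_pos hI
    rw [hw, abs_mul, abs_of_pos (by positivity : 0 < G.m * G.c ^ 2 * G.w I)]
    calc _ ≤ G.p0 p * (G.m * G.c ^ 2 * G.w I) := by gcongr; exact G.abs_fourMom_le p ν
      _ = _ := by ring
  · rw [energyMomentum]
    congr 1
    exact G.invInt_congr fun p I _ => by ring
  · have h0 := invInt_velocity_fourMom_defect hG (h.frame X hX) (h.temperature X hX) ν
    refine Eq.trans (G.invInt_congr fun p I _ => ?_)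
      ((invInt_const_mul _ (G.m * G.c ^ 2)).trans (by rw [h0, mul_zero]))
    rw [hw]
    ring

end Gas
end PennisiRuggeri
end

theorem lemma2p2 (G : PennisiRuggeri.Gas) (hG : G.Admissible) :
    -- the conservation identities, with convergence of all integrals in them
    (∀ F : PennisiRuggeri.R3 → ℝ → ℝ, G.HasEckartFrame F →
      (∃! T : ℝ, G.IsTemperature F T) →
      ∀ T : ℝ, G.IsTemperature F T →
        (∀ μ : Fin 4, G.InvIntegrable (fun p I =>
          G.fourMom p μ * (G.modEquilibrium F T p I - F p I))) ∧
        PennisiRuggeri.mink (G.velocity F) (fun μ => G.invInt (fun p I =>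
          G.fourMom p μ * (G.modEquilibrium F T p I - F p I))) = 0 ∧
        (∀ μ ν : Fin 4, G.InvIntegrable (fun p I =>
          G.fourMom p μ * G.fourMom p ν * (G.modEquilibrium F T p I - F p I) * G.w I)) ∧
        (∀ ν : Fin 4, PennisiRuggeri.mink (G.velocity F) (fun μ => G.invInt (fun p I =>
          G.fourMom p μ * G.fourMom p ν * (G.modEquilibrium F T p I - F p I) * G.w I)) = 0)) ∧
    -- the resulting conservation laws for classical solutions
    (∀ τ : ℝ, 0 < τ → ∀ Ω : Set PennisiRuggeri.Spacetime, IsOpen Ω →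
      ∀ (F : PennisiRuggeri.Spacetime → PennisiRuggeri.R3 → ℝ → ℝ)
        (T : PennisiRuggeri.Spacetime → ℝ),
        G.IsClassicalSolution τ Ω F T →
        ∀ X ∈ Ω,
          (∀ μ : Fin 4, DifferentiableAt ℝ (fun Y => G.particleFlux (F Y) μ) X) ∧
          G.divergence (fun Y => G.particleFlux (F Y)) X = 0 ∧
          (∀ μ ν : Fin 4, DifferentiableAt ℝ (fun Y => G.energyMomentum (F Y) μ ν) X) ∧
          (∀ ν : Fin 4,
            G.divergence (fun Y μ => G.energyMomentum (F Y) μ ν) X = 0)) := by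
  refine ⟨fun F hF _ T hT => ⟨fun μ => ?_, ?_, fun μ ν => ?_, fun ν => ?_⟩,
    fun τ _ Ω hΩ F T h X hX => ?_⟩
  · exact PennisiRuggeri.Gas.invIntegrable_fourMom_defect hG hF hT.1 μ
  · exact PennisiRuggeri.Gas.mink_velocity_defect hG hF hT.1
  · exact (PennisiRuggeri.Gas.invIntegrable_fourMom_two_defect hG hF hT.1 μ ν).congr
      fun p I _ => by ring
  · exact PennisiRuggeri.Gas.mink_velocity_fourMom_defect hG hF hT ν
  · have hV := h.particleFlux_conservation hG hΩ hX
    have hE := fun ν => h.energyMomentum_conservation hG hΩ hX ν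
    exact ⟨hV.1, hV.2, fun μ ν => (hE ν).1 μ, fun ν => (hE ν).2⟩
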